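/- Let $X$ be a complex Banach space and let $T$ be a bounded linear operator on $X$. **Operators on a complex Banach space $Y$.** For a bounded linear operator $S$ on $Y$ let $\alpha(S)=\dim\ker S$ and $\beta(S)=\operatorname{codim}S(Y)$. $S$ is *upper* (resp. *lower*) *semi-Fredholm* if $S(Y)$ is closed and $\alpha(S)<\infty$ (resp. $\beta(S)<\infty$), *semi-Fredholm* if it is one of the two, and *Fredholm* if it is both; for semi-Fredholm $S$ put $\operatorname{ind}(S)=\alpha(S)-\beta(S)\in[-\infty,\infty]$. The ascent $p(S)$ and the descent $q(S)$ are the least $n\ge 0$ with $\ker S^n=\ker S^{n+1}$, resp. $S^n(Y)=S^{n+1}(Y)$ ($\infty$ if there is none). $S$ is *Weyl* if it is Fredholm with $\operatorname{ind}(S)=0$; *upper semi-Weyl* if it is upper semi-Fredholm with $\operatorname{ind}(S)\le 0$; *Browder* if it is Fredholm with $p(S)<\infty$ and $q(S)<\infty$; *upper semi-Browder* if it is upper semi-Fredholm with $p(S)<\infty$; *bounded below* if it is injective with closed range; *semi-regular* if $S(Y)$ is closed and $\ker S\subset S^n(Y)$ for all $n$; *zeroloid* if the spectrum of $S$ has no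 accumulation point other than possibly $0$. **Decompositions.** Write $(M,N)\in\operatorname{Red}(T)$ if $M,N$ are closed $T$-invariant subspaces with $X=M\oplus N$, and let $T_M,T_N$ be the restrictions of $T$ to $M,N$. $T$ is *$g_z$-Fredholm* (resp. *upper semi-$g_z$-Fredholm*, *semi-$g_z$-Fredholm*) if there is $(M,N)\in\operatorname{Red}(T)$ with $T_M$ Fredholm (resp. upper semi-Fredholm, semi-Fredholm) and $T_N$ zeroloid. The index of a semi-$g_z$-Fredholm $T$ is $\operatorname{ind}(T_M)$ for any $(M,N)\in\operatorname{Red}(T)$ with $T_M$ semi-Fredholm and $T_N$ zeroloid. $T$ is *$g_z$-Weyl* if it is $g_z$-Fredholm of index $0$, and *upper semi-$g_z$-Weyl* if it is upper semi-$g_z$-Fredholm of index $\le 0$. $T$ is *left* (resp. *right*) *$g_z$-invertible* if there is $(M,N)\in\operatorname{Red}(T)$ with $T_M$ semi-regular, $T_N$ zeroloid, and $T_M$ bounded below (resp. surjective); it is *$g_z$-invertible* if it is both left and right $g_z$-invertible. **Spectra.** For each class of operators, the corresponding spectrum of $T$ is the set of $\lambda\in\mathbb C$ such that $T-\lambda I$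 is not in the class: $\sigma_w,\sigma_{uw},\sigma_e,\sigma_b,\sigma_{ub}$ for Weyl, upper semi-Weyl, Fredholm, Browder, upper semi-Browder operators; $\sigma_{g_zw},\sigma_{ug_zw},\sigma_{g_zf},\sigma_{g_zd},\sigma_{lg_zd}$ for $g_z$-Weyl, upper semi-$g_z$-Weyl, $g_z$-Fredholm, $g_z$-invertible, left $g_z$-invertible operators. $T$ satisfies *Browder's theorem* if $\sigma_w(T)=\sigma_b(T)$, *essential Browder's theorem* if $\sigma_e(T)=\sigma_b(T)$, and *a-Browder's theorem* if $\sigma_{uw}(T)=\sigma_{ub}(T)$. **Theorem 4.1.** 1. $T$ satisfies Browder's theorem if and only if $\sigma_{g_zw}(T)=\sigma_{g_zd}(T)$. 2. $T$ satisfies essential Browder's theorem if and only if $\sigma_{g_zf}(T)=\sigma_{g_zd}(T)$. 3. $T$ satisfies a-Browder's theorem if and only if $\sigma_{ug_zw}(T)=\sigma_{lg_zd}(T)$. -/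

import Mathlib

open scoped ENNReal

noncomputable section

namespace GzSpectral

/-! ### Single operators on a normed space

`T.ker` and `T.range` are the kernel and the range of `T`. -/

section Operators

variable {Y : Type*} [NormedAddCommGroup Y] [NormedSpace ℂ Y]

/-- `α(T)`: the dimension of the kernel, `⊤` if it is infinite. -/
def nullity (T : Y →L[ℂ] Y) : ℕ∞ := Cardinal.toENat (Module.rank ℂ T.ker)

/-- `β(T)`: the (algebraic) codimension of the range, `⊤` if it is infinite. -/
def defect (T : Y →L[ℂ] Y) : ℕ∞ := Cardinal.toENat (Module.rank ℂ (Y ⧸ T.range))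

/-- `ind(T) = α(T) - β(T)` in `[-∞, ∞]`; only used when `α(T)` or `β(T)` is finite. -/
def ind (T : Y →L[ℂ] Y) : EReal :=
  (((nullity T : ℕ∞) : ℝ≥0∞) : EReal) - (((defect T : ℕ∞) : ℝ≥0∞) : EReal)

/-- The ascent `p(T)`, the least `n` with `N(Tⁿ) = N(Tⁿ⁺¹)`; `⊤` if there is none. -/
def ascent (T : Y →L[ℂ] Y) : ℕ∞ :=
  sInf {k : ℕ∞ | ∃ n : ℕ, k = n ∧ (T ^ n).ker = (T ^ (n + 1)).ker}

/-- The descent `q(T)`, the least `n` with `R(Tⁿ) = R(Tⁿ⁺¹)`; `⊤` if there is none. -/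
def descent (T : Y →L[ℂ] Y) : ℕ∞ :=
  sInf {k : ℕ∞ | ∃ n : ℕ, k = n ∧ (T ^ n).range = (T ^ (n + 1)).range}

/-- Upper semi-Fredholm: closed range and finite-dimensional kernel. -/
def IsUpperSemiFredholm (T : Y →L[ℂ] Y) : Prop :=
  IsClosed (T.range : Set Y) ∧ nullity T < ⊤

/-- Lower semi-Fredholm: closed range of finite codimension. -/
def IsLowerSemiFredholm (T : Y →L[ℂ] Y) : Prop :=
  IsClosed (T.range : Set Y) ∧ defect T < ⊤

def IsSemiFredholm (T : Y →L[ℂ] Y) : Prop :=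
  IsUpperSemiFredholm T ∨ IsLowerSemiFredholm T

/-- Weyl: Fredholm of index zero. -/
def IsWeyl (T : Y →L[ℂ] Y) : Prop := T.IsFredholm ∧ ind T = 0

/-- Upper semi-Weyl: upper semi-Fredholm with `ind(T) ≤ 0`. -/
def IsUpperSemiWeyl (T : Y →L[ℂ] Y) : Prop := IsUpperSemiFredholm T ∧ ind T ≤ 0

/-- Browder: Fredholm of finite ascent and finite descent. -/
def IsBrowder (T : Y →L[ℂ] Y) : Prop := T.IsFredholm ∧ ascent T < ⊤ ∧ descent T < ⊤

/-- Upper semi-Browder: upper semi-Fredholm of finite ascent. -/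
def IsUpperSemiBrowder (T : Y →L[ℂ] Y) : Prop := IsUpperSemiFredholm T ∧ ascent T < ⊤

/-- Bounded below: injective with closed range. -/
def IsBoundedBelow (T : Y →L[ℂ] Y) : Prop := IsUpperSemiFredholm T ∧ nullity T = 0

/-- Semi-regular: closed range, and the kernel is contained in the range of every power. -/
def IsSemiRegular (T : Y →L[ℂ] Y) : Prop :=
  IsClosed (T.range : Set Y) ∧ ∀ n : ℕ, T.ker ≤ (T ^ n).range

/-- Zeroloid: the spectrum has no accumulation point other than (possibly) `0`. -/
def IsZeroloid (T : Y →L[ℂ] Y) : Prop := derivedSet (spectrum ℂ T) ⊆ {0}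

/-- The spectrum attached to a class `P` of operators: all `z` with `T - z I` not in `P`. -/
def spectrumOf (P : (Y →L[ℂ] Y) → Prop) (T : Y →L[ℂ] Y) : Set ℂ :=
  {z | ¬ P (T - z • (1 : Y →L[ℂ] Y))}

end Operators

/-! ### Decompositions `X = M ⊕ N` that reduce `T` -/

section Decompositions

variable {X : Type*} [NormedAddCommGroup X] [NormedSpace ℂ X]

/-- `(M, N) ∈ Red(T)`: `M`, `N` are closed `T`-invariant subspaces and `X = M ⊕ N`.
The restrictions `T_M` and `T_N` are `T.restrict h.invariant_left`,
`T.restrict h.invariant_right`. -/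
structure IsRed (T : X →L[ℂ] X) (M N : Submodule ℂ X) : Prop where
  isClosed_left : IsClosed (M : Set X)
  isClosed_right : IsClosed (N : Set X)
  invariant_left : ∀ x ∈ M, T x ∈ M
  invariant_right : ∀ x ∈ N, T x ∈ N
  isCompl : IsCompl M N

/-- `T` is upper semi-`g_z`-Fredholm. -/
def IsUpperSemiGzFredholm (T : X →L[ℂ] X) : Prop :=
  ∃ (M N : Submodule ℂ X) (h : IsRed T M N),
    IsUpperSemiFredholm (T.restrict h.invariant_left) ∧
      IsZeroloid (T.restrict h.invariant_right)

/-- `T` is `g_z`-Fredholm. -/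
def IsGzFredholm (T : X →L[ℂ] X) : Prop :=
  ∃ (M N : Submodule ℂ X) (h : IsRed T M N),
    (T.restrict h.invariant_left).IsFredholm ∧ IsZeroloid (T.restrict h.invariant_right)

/-- `k` is the index of the semi-`g_z`-Fredholm operator `T`: the index of `T_M` for
some `(M, N) ∈ Red(T)` with `T_M` semi-Fredholm and `T_N` zeroloid. -/
def HasGzIndex (T : X →L[ℂ] X) (k : EReal) : Prop :=
  ∃ (M N : Submodule ℂ X) (h : IsRed T M N),
    IsSemiFredholm (T.restrict h.invariant_left) ∧
      IsZeroloid (T.restrict h.invariant_right) ∧ ind (T.restrict h.invariant_left) = k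

/-- `g_z`-Weyl: `g_z`-Fredholm of index zero. -/
def IsGzWeyl (T : X →L[ℂ] X) : Prop := IsGzFredholm T ∧ HasGzIndex T 0

/-- Upper semi-`g_z`-Weyl: upper semi-`g_z`-Fredholm of index at most zero. -/
def IsUpperSemiGzWeyl (T : X →L[ℂ] X) : Prop :=
  IsUpperSemiGzFredholm T ∧ ∃ k : EReal, HasGzIndex T k ∧ k ≤ 0

/-- `(M, N) ∈ g_zKD(T)`: a generalized Kato zeroloid decomposition of `T`. -/
structure IsGzKD (T : X →L[ℂ] X) (M N : Submodule ℂ X) : Prop extends IsRed T M N where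
  semiRegular_left : IsSemiRegular (T.restrict invariant_left)
  zeroloid_right : IsZeroloid (T.restrict invariant_right)

/-- `T` is left `g_z`-invertible. -/
def IsLeftGzInvertible (T : X →L[ℂ] X) : Prop :=
  ∃ (M N : Submodule ℂ X) (h : IsGzKD T M N), IsBoundedBelow (T.restrict h.invariant_left)

/-- `T` is right `g_z`-invertible. -/
def IsRightGzInvertible (T : X →L[ℂ] X) : Prop :=
  ∃ (M N : Submodule ℂ X) (h : IsGzKD T M N),
    Function.Surjective (T.restrict h.invariant_left)

/-- `T` is `g_z`-invertible: left and right `g_z`-invertible. -/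
def IsGzInvertible (T : X →L[ℂ] X) : Prop := IsLeftGzInvertible T ∧ IsRightGzInvertible T

end Decompositions

/-! ### The three Browder-type theorems for a given operator -/

section BrowderTheorems

variable {X : Type*} [NormedAddCommGroup X] [NormedSpace ℂ X]

/-- `T ∈ (B)`: the Weyl spectrum equals the Browder spectrum. -/
def SatisfiesBrowder (T : X →L[ℂ] X) : Prop :=
  spectrumOf IsWeyl T = spectrumOf IsBrowder T

/-- `T ∈ (B_e)`: the essential (Fredholm) spectrum equals the Browder spectrum. -/
def SatisfiesEssentialBrowder (T : X →L[ℂ] X) : Prop :=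
  spectrumOf ContinuousLinearMap.IsFredholm T = spectrumOf IsBrowder T

/-- `T ∈ (aB)`: the upper semi-Weyl spectrum equals the upper semi-Browder spectrum. -/
def SatisfiesABrowder (T : X →L[ℂ] X) : Prop :=
  spectrumOf IsUpperSemiWeyl T = spectrumOf IsUpperSemiBrowder T

end BrowderTheorems

end GzSpectral

end

open GzSpectral

/-! Suppose `S = T - z` splits as `S_M ⊕ S_N` with `S_M` upper semi-Fredholm and `S_N` zeroloid.
There are arbitrarily small `w` outside the spectrum of `S_N`, and for these `S - w` has the
nullity, defect and closedness of range of `S_M - w` (`IsRed.exists_small`). By stability of the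
index (`IsUpperSemiFredholm.exists_perturbation`), `S - w` is then Weyl, Fredholm or upper semi-Weyl
according to `S_M`. The Browder-type hypothesis at `z + w` gives `S - w`, hence `S_M - w`, finite
ascent.

Finite ascent at arbitrarily small `w` forces finite ascent of `S_M` itself
(`IsUpperSemiFredholm.ascent_lt_top`). An upper semi-Fredholm operator of finite ascent is a bounded
below operator plus a finite-dimensional one (`IsUpperSemiFredholm.exists_isRed`). The
finite-dimensional summand is absorbed into `N`, so `S` is left `g_z`-invertible, and
`g_z`-invertible when `S_M` has index zero.

Conversely, a classical operator lies in its `g_z`-class through the pair `(⊤, ⊥)`. If that makes it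
left `g_z`-invertible, then `S - w` is injective for suitable small `w`, and the same ascent lemma
applies. Two facts complete the two-sided cases: Browder means Weyl of finite ascent
(`isBrowder_iff`), and a left and a right `g_z`-inverting pair yield one pair with bijective left
part (`IsGzInvertible.exists_bijective`). -/

namespace GzSpectral

/-! ### Dimension counts for kernels and quotients -/

section Algebra

variable {Y : Type*} [NormedAddCommGroup Y] [NormedSpace ℂ Y]

/-- The codimension of a subspace, `⊤` if it is infinite. -/
noncomputable def codim (Z : Submodule ℂ Y) : ℕ∞ := Cardinal.toENat (Module.rank ℂ (Y ⧸ Z))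

lemma defect_eq_codim (S : Y →L[ℂ] Y) : defect S = codim S.range := rfl

lemma nullity_lt_top {S : Y →L[ℂ] Y} : nullity S < ⊤ ↔ FiniteDimensional ℂ S.ker := by
  rw [nullity, Cardinal.toENat_lt_top, Module.rank_lt_aleph0_iff]

lemma nullity_eq_zero {S : Y →L[ℂ] Y} : nullity S = 0 ↔ Function.Injective S := by
  rw [nullity, Cardinal.toENat_eq_zero, rank_zero_iff, Submodule.subsingleton_iff_eq_bot,
    LinearMap.ker_eq_bot]; rfl

lemma codim_lt_top {Z : Submodule ℂ Y} : codim Z < ⊤ ↔ FiniteDimensional ℂ (Y ⧸ Z) := by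
  rw [codim, Cardinal.toENat_lt_top, Module.rank_lt_aleph0_iff]

lemma codim_antitone {Z W : Submodule ℂ Y} (h : Z ≤ W) : codim W ≤ codim Z :=
  OrderHomClass.mono _ (LinearMap.rank_le_of_surjective _ (Submodule.factor_surjective h))

lemma defect_eq_zero {S : Y →L[ℂ] Y} : defect S = 0 ↔ Function.Surjective S := by
  rw [defect, Cardinal.toENat_eq_zero, rank_zero_iff, Submodule.Quotient.subsingleton_iff,
    LinearMap.range_eq_top]; rfl

lemma codim_eq_of_isCompl {Z F : Submodule ℂ Y} (h : IsCompl Z F) :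
    codim Z = Cardinal.toENat (Module.rank ℂ F) := by
  rw [codim, (Submodule.quotientEquivOfIsCompl Z F h).rank_eq]

lemma rank_le_codim {Z F : Submodule ℂ Y} (h : Disjoint Z F) :
    Cardinal.toENat (Module.rank ℂ F) ≤ codim Z := by
  refine OrderHomClass.mono _ (LinearMap.rank_le_of_injective (Z.mkQ ∘ₗ F.subtype) ?_)
  rw [← LinearMap.ker_eq_bot, LinearMap.ker_comp, Submodule.ker_mkQ,
    ← Submodule.disjoint_iff_comap_eq_bot]
  exact h.symm

/-- Here `r` is the rank of the map `Y ⧸ Z → Y ⧸ S(Z)` induced by `S`, whose kernel is a copy of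
`ker S` and whose cokernel is `Y ⧸ S(Y)`. Keeping `r` explicit allows indices to be compared without
subtracting infinities. -/
lemma exists_nullity_add (S : Y →L[ℂ] Y) (Z : Submodule ℂ Y) (hd : Disjoint Z S.ker) :
    ∃ r : ℕ∞, nullity S + r = codim Z ∧ codim (Z.map S.toLinearMap) = r + defect S := by
  set φ := Z.mapQ (Z.map S.toLinearMap) S.toLinearMap (Submodule.le_comap_map _ _) with hφ
  refine ⟨Cardinal.toENat (Module.rank ℂ φ.range), ?_, ?_⟩
  · have h1 : ∀ x : S.ker, Z.mkQ x ∈ φ.ker := by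
      rintro ⟨x, hx⟩
      have hx' : S x = 0 := hx
      simp [hφ, hx']
    let ψ : S.ker →ₗ[ℂ] φ.ker := (Z.mkQ ∘ₗ S.ker.subtype).codRestrict _ h1
    have hψ : Function.Bijective ψ := by
      constructor
      · have : Function.Injective (Z.mkQ ∘ₗ S.ker.subtype) := by
          rw [← LinearMap.ker_eq_bot, LinearMap.ker_comp, Submodule.ker_mkQ,
            ← Submodule.disjoint_iff_comap_eq_bot]
          exact hd.symm
        exact fun x y h ↦ this (congrArg Subtype.val h)
      · rintro ⟨y, hy⟩
        obtain ⟨y, rfl⟩ := Z.mkQ_surjective y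
        have : S y ∈ Z.map S.toLinearMap := by simpa [hφ] using hy
        obtain ⟨z, hz, hzy⟩ := this
        refine ⟨⟨y - z, ?_⟩, ?_⟩
        · have : S z = S y := hzy
          simp [this]
        · apply Subtype.ext
          change Z.mkQ (y - z) = Z.mkQ y
          rw [map_sub, sub_eq_self]
          simpa using hz
    rw [nullity, (LinearEquiv.ofBijective ψ hψ).rank_eq, codim, ← map_add, add_comm,
      LinearMap.rank_range_add_rank_ker]
  · have h2 : φ.range = S.range.map (Z.map S.toLinearMap).mkQ := Submodule.range_mapQ ..
    have e : ((Y ⧸ Z.map S.toLinearMap) ⧸ φ.range) ≃ₗ[ℂ] Y ⧸ S.range :=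
      (Submodule.quotEquivOfEq _ _ h2).trans
        (Submodule.quotientQuotientEquivQuotient _ _ LinearMap.map_le_range)
    rw [defect, ← e.rank_eq, ← map_add, add_comm, Submodule.rank_quotient_add_rank, codim]

end Algebra

/-! ### The index as a comparison of nullity and defect -/

section Index

variable {Y : Type*} [NormedAddCommGroup Y] [NormedSpace ℂ Y]

lemma ind_nonpos_iff {S : Y →L[ℂ] Y} : ind S ≤ 0 ↔ nullity S ≤ defect S := by
  rw [ind]
  generalize nullity S = a
  generalize defect S = b
  rcases eq_or_ne a ⊤ with rfl | ha <;> rcases eq_or_ne b ⊤ with rfl | hb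
  · simp
  · lift b to ℕ using hb
    simp
  · simp
  · lift a to ℕ using ha
    lift b to ℕ using hb
    rw [EReal.sub_nonpos]; simp

/-- In `EReal`, `⊤ - ⊤ = ⊥`, so index zero excludes infinite nullity and defect. -/
lemma ind_eq_zero_iff {S : Y →L[ℂ] Y} :
    ind S = 0 ↔ nullity S = defect S ∧ nullity S < ⊤ := by
  rw [ind]
  generalize nullity S = a
  generalize defect S = b
  rcases eq_or_ne a ⊤ with rfl | ha <;> rcases eq_or_ne b ⊤ with rfl | hb
  · simp
  · lift b to ℕ using hb
    simp
  · simp [ha]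
  · lift a to ℕ using ha
    lift b to ℕ using hb
    have hc : ∀ n : ℕ, (((n : ℕ∞) : ℝ≥0∞) : EReal) = ((n : ℝ) : EReal) := by
      intro n
      simpa using EReal.coe_nnreal_eq_coe_real n
    rw [hc, hc, ← EReal.coe_sub, EReal.coe_eq_zero, sub_eq_zero, Nat.cast_inj]
    simp

end Index

/-! ### Small perturbations of injective operators -/

section Perturbation

variable {E F : Type*} [NormedAddCommGroup E] [NormedSpace ℂ E] [CompleteSpace E]
  [NormedAddCommGroup F] [NormedSpace ℂ F] [CompleteSpace F]

lemma exists_perturbation_injective {R : E →L[ℂ] F} (hi : Function.Injective R)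
    (hc : IsClosed (Set.range R)) :
    ∃ ε > 0, ∀ R' : E →L[ℂ] F, ‖R' - R‖ < ε →
      Function.Injective R' ∧ IsClosed (Set.range R') := by
  obtain ⟨K, hK⟩ := R.antilipschitz_of_injective_of_isClosed_range hi hc
  -- `K` may be zero; `K + 1` has a positive inverse to serve as radius.
  have hK' : AntilipschitzWith (K + 1) R := fun x y ↦ (hK x y).trans (by gcongr; simp)
  refine ⟨((K + 1)⁻¹ : NNReal), by positivity, fun R' hR' ↦ ?_⟩
  have h := hK'.add_lipschitzWith (R' - R).lipschitz (by exact_mod_cast hR')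
  have h' : (fun x ↦ R x + (R' - R) x) = R' := by ext; simp
  rw [h'] at h
  exact ⟨h.injective, h.isClosed_range R'.uniformContinuous⟩

lemma exists_perturbation_bijective {R : E →L[ℂ] F} (hb : Function.Bijective R) :
    ∃ ε > 0, ∀ R' : E →L[ℂ] F, ‖R' - R‖ < ε → Function.Bijective R' := by
  let e := ContinuousLinearEquiv.ofBijective R (LinearMap.ker_eq_bot.2 hb.1)
    (LinearMap.range_eq_top.2 hb.2)
  obtain ⟨ε, hε, h⟩ := Metric.mem_nhds_iff.1 e.nhds
  refine ⟨ε, hε, fun R' hR' ↦ ?_⟩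
  have : (e : E →L[ℂ] F) = R := ContinuousLinearEquiv.coe_ofBijective ..
  obtain ⟨e', rfl⟩ := h (by rwa [mem_ball_iff_norm, this] : R' ∈ Metric.ball (e : E →L[ℂ] F) ε)
  exact e'.bijective

omit [CompleteSpace E] [CompleteSpace F] in
lemma norm_coprod_sub_coprod_le {G : Type*} [NormedAddCommGroup G] [NormedSpace ℂ G]
    (R R' : E →L[ℂ] F) (j : G →L[ℂ] F) : ‖R'.coprod j - R.coprod j‖ ≤ ‖R' - R‖ := by
  refine ContinuousLinearMap.opNorm_le_bound _ (norm_nonneg _) fun x ↦ ?_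
  have : (R'.coprod j - R.coprod j) x = (R' - R) x.1 := by simp
  rw [this]
  exact (ContinuousLinearMap.le_opNorm _ _).trans (by gcongr; exact norm_fst_le x)

omit [CompleteSpace E] [CompleteSpace F] in
lemma injective_coprod {G : Type*} [NormedAddCommGroup G] [NormedSpace ℂ G] {R : E →L[ℂ] F}
    {j : G →L[ℂ] F} (hR : Function.Injective R) (hj : Function.Injective j)
    (hd : Disjoint R.range j.range) : Function.Injective (R.coprod j) := by
  have h := LinearMap.ker_coprod_of_disjoint_range R.toLinearMap j.toLinearMap hd
  rw [LinearMap.ker_eq_bot.2 hR, LinearMap.ker_eq_bot.2 hj, Submodule.prod_bot] at h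
  exact LinearMap.ker_eq_bot.1 h

omit [CompleteSpace E] [CompleteSpace F] in
lemma disjoint_range_of_injective_coprod {G : Type*} [NormedAddCommGroup G] [NormedSpace ℂ G]
    {R : E →L[ℂ] F} {j : G →L[ℂ] F} (h : Function.Injective (R.coprod j)) :
    Disjoint R.range j.range := by
  rw [Submodule.disjoint_def]
  rintro _ ⟨x, rfl⟩ ⟨y, hy⟩
  have hy : j y = R x := hy
  have : (x, -y) = (0, 0) := h (by simp [hy])
  have hx : x = 0 := congrArg Prod.fst this
  simp [hx]

/-- Adjoin to `R` an injection `j` of `ℂ^a` into a complement of its range. The joint map is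
injective with closed range, a stable property, so the range of `R'` still misses the
`a`-dimensional range of `j`. -/
lemma exists_perturbation_le_codim {R : E →L[ℂ] F} (hi : Function.Injective R)
    (hc : IsClosed (Set.range R)) {a : ℕ} (ha : a ≤ codim R.range) :
    ∃ ε > 0, ∀ R' : E →L[ℂ] F, ‖R' - R‖ < ε → a ≤ codim R'.range := by
  obtain ⟨G, hG⟩ := Submodule.exists_isCompl R.range
  rw [codim_eq_of_isCompl hG] at ha
  have ha' : (a : Cardinal) ≤ Module.rank ℂ G := by simpa using ha
  obtain ⟨f, hf⟩ := Module.le_rank_iff_exists_linearMap.1 ha'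
  let j : (Fin a → ℂ) →L[ℂ] F := LinearMap.toContinuousLinearMap (G.subtype ∘ₗ f)
  have hj : Function.Injective j := G.injective_subtype.comp hf
  have hjG : j.range ≤ G := by
    rintro _ ⟨x, rfl⟩
    exact (f x).2
  have hΦ : Function.Injective (R.coprod j) := injective_coprod hi hj (hG.disjoint.mono_right hjG)
  have hΦc : IsClosed (Set.range (R.coprod j)) := by
    have := Submodule.isClosed_sup_finiteDimensional R.range j.range hc
    rwa [← ContinuousLinearMap.range_coprod] at this
  obtain ⟨ε, hε, h⟩ := exists_perturbation_injective hΦ hΦc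
  refine ⟨ε, hε, fun R' hR' ↦ ?_⟩
  have h1 := (h (R'.coprod j) ((norm_coprod_sub_coprod_le R R' j).trans_lt hR')).1
  have h2 := rank_le_codim (disjoint_range_of_injective_coprod h1)
  refine le_trans ?_ h2
  have h3 : (a : Cardinal) ≤ Module.rank ℂ j.range :=
    Module.le_rank_iff_exists_linearMap.2
      ⟨j.toLinearMap.rangeRestrict, fun x y hxy ↦ hj (congrArg (fun z : j.range ↦ (z : F)) hxy)⟩
  simpa using h3

/-- Adjoining a whole complement `G` makes the map bijective, an open condition, so `G` also
complements the range of `R'`. -/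
lemma exists_perturbation_codim_eq {R : E →L[ℂ] F} (hi : Function.Injective R)
    (hf : codim R.range < ⊤) :
    ∃ ε > 0, ∀ R' : E →L[ℂ] F, ‖R' - R‖ < ε → codim R'.range = codim R.range := by
  obtain ⟨G, hG⟩ := Submodule.exists_isCompl R.range
  have hfin : FiniteDimensional ℂ G := by
    have := codim_lt_top.1 hf
    exact (Submodule.quotientEquivOfIsCompl _ _ hG).finiteDimensional
  have hrG : G.subtypeL.range = G := G.range_subtype
  have hΦ : Function.Bijective (R.coprod G.subtypeL) := by
    refine ⟨injective_coprod hi G.injective_subtype (by rw [hrG]; exact hG.disjoint), ?_⟩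
    have : (R.coprod G.subtypeL).range = ⊤ := by
      rw [ContinuousLinearMap.range_coprod, hrG, hG.sup_eq_top]
    exact LinearMap.range_eq_top.1 this
  obtain ⟨ε, hε, h⟩ := exists_perturbation_bijective hΦ
  refine ⟨ε, hε, fun R' hR' ↦ ?_⟩
  have h1 := h (R'.coprod G.subtypeL) ((norm_coprod_sub_coprod_le R R' _).trans_lt hR')
  have hG' : IsCompl R'.range G := by
    constructor
    · have := disjoint_range_of_injective_coprod h1.1
      rwa [hrG] at this
    · rw [codisjoint_iff]
      have : (R'.coprod G.subtypeL).range = ⊤ := LinearMap.range_eq_top.2 h1.2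
      rwa [ContinuousLinearMap.range_coprod, hrG] at this
  rw [codim_eq_of_isCompl hG, codim_eq_of_isCompl hG']

end Perturbation

/-! ### Stability of semi-Fredholm operators and of the sign of the index -/

section Stability

variable {Y : Type*} [NormedAddCommGroup Y] [NormedSpace ℂ Y] [CompleteSpace Y]

lemma isFredholm_iff {S : Y →L[ℂ] Y} : S.IsFredholm ↔ IsUpperSemiFredholm S ∧ defect S < ⊤ := by
  constructor
  · intro h
    exact ⟨⟨h.isClosed_range, nullity_lt_top.2 h.finite_ker⟩, codim_lt_top.2 h.finite_coker⟩
  · rintro ⟨⟨h1, h2⟩, h3⟩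
    have := nullity_lt_top.1 h2
    refine ⟨?_, h1, this, codim_lt_top.1 h3, .of_finiteDimensional _⟩
    have hcomp : CompleteSpace S.range := h1.completeSpace_coe
    have hs : Function.Surjective S.rangeRestrict := S.toLinearMap.surjective_rangeRestrict
    -- The open mapping theorem onto the complete range supplies strictness.
    have h4 := (S.rangeRestrict.isOpenMap hs).isStrictMap S.rangeRestrict.continuous
    exact (Topology.IsEmbedding.subtypeVal.isStrictMap_iff (f := S.rangeRestrict)).1 h4

omit [CompleteSpace Y] in
/-- A closed complement of the kernel of an upper semi-Fredholm operator. -/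
lemma IsUpperSemiFredholm.exists_complement {S : Y →L[ℂ] Y} (h : IsUpperSemiFredholm S) :
    ∃ Z : Submodule ℂ Y, IsClosed (Z : Set Y) ∧ IsCompl S.ker Z ∧ codim Z = nullity S := by
  have := nullity_lt_top.1 h.2
  obtain ⟨Z, hZ, hc⟩ :=
    (Submodule.ClosedComplemented.of_finiteDimensional S.ker).exists_isClosed_isCompl
  exact ⟨Z, hZ, hc, codim_eq_of_isCompl hc.symm⟩

omit [CompleteSpace Y] in
lemma range_domRestrict_eq_map {Z : Submodule ℂ Y} (R : Y →L[ℂ] Y) :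
    (R.domRestrict Z).range = Z.map R.toLinearMap :=
  R.toLinearMap.range_domRestrict Z

omit [CompleteSpace Y] in
lemma injective_domRestrict_iff {Z : Submodule ℂ Y} {R : Y →L[ℂ] Y} :
    Function.Injective (R.domRestrict Z) ↔ Disjoint Z R.ker := by
  rw [Submodule.disjoint_iff_comap_eq_bot, ← LinearMap.ker_domRestrict]
  exact LinearMap.ker_eq_bot.symm

omit [CompleteSpace Y] in
lemma range_domRestrict_of_isCompl {Z : Submodule ℂ Y} {R : Y →L[ℂ] Y} (hc : IsCompl R.ker Z) :
    (R.domRestrict Z).range = R.range := by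
  rw [range_domRestrict_eq_map, ← Submodule.map_top, ← hc.sup_eq_top, Submodule.map_sup,
    right_eq_sup]
  rintro _ ⟨x, hx, rfl⟩
  rw [show R.toLinearMap x = 0 from hx]
  exact zero_mem _

/-- On a closed complement `Z` of `ker S` the operator is injective with closed range, so the
codimension of `S'(Z)` is controlled. `exists_nullity_add` gives `nullity S' + r = nullity S` and
`codim S'(Z) = r + defect S'`; cancelling the finite `r` yields the comparisons. -/
lemma IsUpperSemiFredholm.exists_perturbation {S : Y →L[ℂ] Y} (h : IsUpperSemiFredholm S) :
    ∃ ε > 0, ∀ S' : Y →L[ℂ] Y, ‖S' - S‖ < ε → IsUpperSemiFredholm S' ∧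
      (nullity S ≤ defect S → nullity S' ≤ defect S') ∧
      (defect S < ⊤ → defect S' < ⊤ ∧ (nullity S = defect S ↔ nullity S' = defect S')) := by
  obtain ⟨Z, hZ, hc, ha⟩ := h.exists_complement
  have : CompleteSpace Z := hZ.completeSpace_coe
  have hr := range_domRestrict_eq_map (Z := Z)
  have hi := (injective_domRestrict_iff (Z := Z)).2 hc.symm.disjoint
  have hrS := range_domRestrict_of_isCompl hc
  have hcl : IsClosed (Set.range (S.domRestrict Z)) := by
    have := h.1
    rwa [← hrS] at this
  have hfin := h.2
  have hna : codim Z < ⊤ := ha ▸ h.2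
  have := codim_lt_top.1 hna
  have hnorm : ∀ S' : Y →L[ℂ] Y, ‖S'.domRestrict Z - S.domRestrict Z‖ ≤ ‖S' - S‖ := by
    intro S'
    refine ContinuousLinearMap.opNorm_le_bound _ (norm_nonneg _) fun x ↦ ?_
    exact (S' - S).le_opNorm x
  obtain ⟨ε₁, hε₁, h1⟩ := exists_perturbation_injective hi hcl
  obtain ⟨ε₂, hε₂, h2⟩ : ∃ ε > 0, ∀ R' : Z →L[ℂ] Y, ‖R' - S.domRestrict Z‖ < ε →
      (nullity S ≤ defect S → nullity S ≤ codim R'.range) := by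
    by_cases hle : nullity S ≤ defect S
    · rw [defect_eq_codim, ← hrS] at hle
      obtain ⟨a, ha⟩ := ENat.ne_top_iff_exists.1 hfin.ne
      rw [← ha] at hle ⊢
      obtain ⟨ε, hε, H⟩ := exists_perturbation_le_codim hi hcl hle
      exact ⟨ε, hε, fun R' hR' _ ↦ H R' hR'⟩
    · exact ⟨1, one_pos, fun _ _ h ↦ absurd h hle⟩
  obtain ⟨ε₃, hε₃, h3⟩ : ∃ ε > 0, ∀ R' : Z →L[ℂ] Y, ‖R' - S.domRestrict Z‖ < ε →
      (defect S < ⊤ → codim R'.range = defect S) := by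
    by_cases hle : defect S < ⊤
    · rw [defect_eq_codim, ← hrS] at hle ⊢
      obtain ⟨ε, hε, H⟩ := exists_perturbation_codim_eq hi hle
      exact ⟨ε, hε, fun R' hR' _ ↦ H R' hR'⟩
    · exact ⟨1, one_pos, fun _ _ h ↦ absurd h hle⟩
  refine ⟨min ε₁ (min ε₂ ε₃), by positivity, fun S' hS' ↦ ?_⟩
  have hS' := (hnorm S').trans_lt hS'
  rw [lt_min_iff, lt_min_iff] at hS'
  obtain ⟨hi', hcl'⟩ := h1 _ hS'.1
  have h2 := h2 _ hS'.2.1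
  have h3 := h3 _ hS'.2.2
  rw [hr] at h2 h3
  have hd : Disjoint Z S'.ker := injective_domRestrict_iff.1 hi'
  obtain ⟨r, hr1, hr2⟩ := exists_nullity_add S' Z hd
  rw [ha] at hr1
  have hrtop : r ≠ ⊤ := fun h ↦ by simp [h] at hr1; exact hfin.ne hr1.symm
  refine ⟨⟨?_, ?_⟩, fun hle ↦ ?_, fun hdef ↦ ?_⟩
  · refine LinearMap.isClosed_range_of_isClosed_map_of_finiteDimensional_quotient (s := Z) ?_
    rw [← hr]
    exact hcl'
  · exact lt_of_le_of_lt (le_self_add.trans hr1.le) hfin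
  · have := h2 hle
    rw [hr2, ← hr1, add_comm] at this
    exact (ENat.add_le_add_iff_left hrtop).1 this
  · have := h3 hdef
    rw [hr2] at this
    refine ⟨lt_of_le_of_lt (le_add_self.trans this.le) hdef, ?_⟩
    rw [← this, ← hr1, add_comm]
    exact (ENat.add_right_injective_of_ne_top hrtop).eq_iff

end Stability

/-! ### Ascent and descent -/

section Ascent

variable {Y : Type*} [NormedAddCommGroup Y] [NormedSpace ℂ Y]

lemma ascent_lt_top {T : Y →L[ℂ] Y} :
    ascent T < ⊤ ↔ ∃ n : ℕ, ∀ x, (T ^ (n + 1)) x = 0 → (T ^ n) x = 0 := by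
  have h : ∀ n : ℕ, (T ^ n).ker = (T ^ (n + 1)).ker ↔ ∀ x, (T ^ (n + 1)) x = 0 → (T ^ n) x = 0 := by
    intro n
    refine ⟨fun h x hx ↦ ?_, fun h ↦ le_antisymm (fun x hx ↦ ?_) h⟩
    · have : x ∈ (T ^ (n + 1)).ker := hx
      rwa [← h] at this
    · have : (T ^ n) x = 0 := hx
      change (T ^ (n + 1)) x = 0
      rw [pow_succ']
      simp [this]
  simp_rw [ascent, sInf_lt_iff, Set.mem_ofPred_eq, h]
  constructor
  · rintro ⟨_, ⟨n, -, hn⟩, -⟩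
    exact ⟨n, hn⟩
  · rintro ⟨n, hn⟩
    exact ⟨n, ⟨n, rfl, hn⟩, ENat.natCast_lt_top n⟩

lemma descent_lt_top {T : Y →L[ℂ] Y} :
    descent T < ⊤ ↔ ∃ n : ℕ, ∀ x, ∃ y, (T ^ (n + 1)) y = (T ^ n) x := by
  have h : ∀ n : ℕ, (T ^ n).range = (T ^ (n + 1)).range ↔
      ∀ x, ∃ y, (T ^ (n + 1)) y = (T ^ n) x := by
    intro n
    refine ⟨fun h x ↦ ?_, fun h ↦ le_antisymm ?_ ?_⟩
    · have : (T ^ n) x ∈ (T ^ n).range := ⟨x, rfl⟩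
      rwa [h] at this
    · rintro _ ⟨x, rfl⟩
      exact h x
    · rintro _ ⟨x, rfl⟩
      exact ⟨T x, by rw [pow_succ]; rfl⟩
  simp_rw [descent, sInf_lt_iff, Set.mem_ofPred_eq, h]
  constructor
  · rintro ⟨_, ⟨n, -, hn⟩, -⟩
    exact ⟨n, hn⟩
  · rintro ⟨n, hn⟩
    exact ⟨n, ⟨n, rfl, hn⟩, ENat.natCast_lt_top n⟩

lemma pow_succ_apply' (T : Y →L[ℂ] Y) (n : ℕ) (x : Y) : (T ^ (n + 1)) x = T ((T ^ n) x) := by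
  rw [pow_succ']; rfl

lemma pow_succ_apply (T : Y →L[ℂ] Y) (n : ℕ) (x : Y) : (T ^ (n + 1)) x = (T ^ n) (T x) := by
  rw [pow_succ]; rfl

/-- A surjective operator on an invariant set with a nonzero kernel vector has infinite ascent. -/
lemma eq_zero_of_ascent_lt_top {T : Y →L[ℂ] Y} (hT : ascent T < ⊤) {V : Set Y}
    (hV : ∀ x ∈ V, ∃ y ∈ V, T y = x) {x : Y} (hx : x ∈ V) (h0 : T x = 0) : x = 0 := by
  obtain ⟨n, hn⟩ := ascent_lt_top.1 hT
  have : ∀ k : ℕ, ∃ y ∈ V, (T ^ k) y = x := by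
    intro k
    induction k with
    | zero => exact ⟨x, hx, rfl⟩
    | succ k ih =>
      obtain ⟨y, hy, hyx⟩ := ih
      obtain ⟨z, hz, hzy⟩ := hV y hy
      exact ⟨z, hz, by rw [pow_succ_apply, hzy, hyx]⟩
  obtain ⟨y, -, hy⟩ := this n
  rw [← hy]
  exact hn y (by rw [pow_succ_apply', hy, h0])

end Ascent

/-! ### Finite ascent passes from nearby translates to the operator -/

section PuncturedAscent

variable {Y : Type*} [NormedAddCommGroup Y] [NormedSpace ℂ Y] [CompleteSpace Y]

/-- `S(W)` is the image of `(W + ker S) ∩ Z`, for a closed complement `Z` of `ker S`; `W + ker S` is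
closed and `S` is a closed embedding on `Z`. -/
lemma IsUpperSemiFredholm.isClosed_map {S : Y →L[ℂ] Y} (h : IsUpperSemiFredholm S)
    {W : Submodule ℂ Y} (hW : IsClosed (W : Set Y)) :
    IsClosed (W.map S.toLinearMap : Set Y) := by
  obtain ⟨Z, hZ, hc, -⟩ := h.exists_complement
  have : CompleteSpace Z := hZ.completeSpace_coe
  have hi := (injective_domRestrict_iff (Z := Z)).2 hc.symm.disjoint
  have hcl : IsClosed (Set.range (S.domRestrict Z)) := by
    have := h.1
    rwa [← range_domRestrict_of_isCompl hc] at this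
  obtain ⟨K, hK⟩ := (S.domRestrict Z).antilipschitz_of_injective_of_isClosed_range hi hcl
  have := nullity_lt_top.1 h.2
  have hW' : IsClosed ((W ⊔ S.ker : Submodule ℂ Y) : Set Y) :=
    Submodule.isClosed_sup_finiteDimensional _ _ hW
  have hcl2 := (hK.isClosedEmbedding (S.domRestrict Z).uniformContinuous).isClosedMap _
    (hW'.preimage Z.subtypeL.continuous)
  convert hcl2 using 1
  ext y
  constructor
  · rintro ⟨w, hw, rfl⟩
    have hw' : w ∈ S.ker ⊔ Z := hc.sup_eq_top ▸ Submodule.mem_top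
    obtain ⟨k, hk, z, hz, rfl⟩ := Submodule.mem_sup.1 hw'
    have hk0 : S k = 0 := hk
    refine ⟨⟨z, hz⟩, ?_, ?_⟩
    · exact Submodule.mem_sup.2 ⟨k + z, hw, -k, neg_mem hk, by simp⟩
    · change S z = S (k + z)
      simp [hk0]
  · rintro ⟨⟨z, hz⟩, hzw, rfl⟩
    obtain ⟨w, hw, k, hk, hwk⟩ := Submodule.mem_sup.1 hzw
    have hk0 : S k = 0 := hk
    refine ⟨w, hw, ?_⟩
    change S w = S z
    have : w + k = z := hwk
    simp [← this, hk0]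

lemma IsUpperSemiFredholm.isClosed_range_pow {S : Y →L[ℂ] Y} (h : IsUpperSemiFredholm S) (n : ℕ) :
    IsClosed ((S ^ n).range : Set Y) := by
  induction n with
  | zero =>
    have : (S ^ 0).range = ⊤ := LinearMap.range_eq_top.2 fun x ↦ ⟨x, rfl⟩
    rw [this]
    exact isClosed_univ
  | succ n ih =>
    convert h.isClosed_map ih using 1
    ext y
    constructor
    · rintro ⟨x, rfl⟩
      exact ⟨_, ⟨x, rfl⟩, (pow_succ_apply' S n x).symm⟩
    · rintro ⟨_, ⟨x, rfl⟩, rfl⟩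
      exact ⟨x, pow_succ_apply' S n x⟩

/-- `R'` stays bijective on a complement `Z` of `ker R`. If `k ∈ ker R`, then `R' k = R' z` for some
`z ∈ Z`; injectivity of `R'` puts `k` in `Z ∩ ker R = 0`. -/
lemma exists_perturbation_surjective_injective {R : Y →L[ℂ] Y} (hs : Function.Surjective R)
    (hf : nullity R < ⊤) :
    ∃ ε > 0, ∀ R' : Y →L[ℂ] Y, ‖R' - R‖ < ε → Function.Surjective R' ∧
      (Function.Injective R' → Function.Injective R) := by
  have h : IsUpperSemiFredholm R := by
    refine ⟨?_, hf⟩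
    rw [LinearMap.range_eq_top.2 hs]
    exact isClosed_univ
  obtain ⟨Z, hZ, hc, -⟩ := h.exists_complement
  have : CompleteSpace Z := hZ.completeSpace_coe
  have hb : Function.Bijective (R.domRestrict Z) := by
    refine ⟨(injective_domRestrict_iff (Z := Z)).2 hc.symm.disjoint, LinearMap.range_eq_top.1 ?_⟩
    rw [range_domRestrict_of_isCompl hc, LinearMap.range_eq_top.2 hs]
  obtain ⟨ε, hε, H⟩ := exists_perturbation_bijective hb
  refine ⟨ε, hε, fun R' hR' ↦ ?_⟩
  have hR'' : ‖R'.domRestrict Z - R.domRestrict Z‖ ≤ ‖R' - R‖ :=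
    ContinuousLinearMap.opNorm_le_bound _ (norm_nonneg _) fun x ↦ (R' - R).le_opNorm x
  obtain ⟨hi', hs'⟩ := H _ (hR''.trans_lt hR')
  refine ⟨fun y ↦ ?_, fun hinj ↦ ?_⟩
  · obtain ⟨z, hz⟩ := hs' y
    exact ⟨z, hz⟩
  · refine (injective_iff_map_eq_zero _).2 fun k hk ↦ ?_
    obtain ⟨z, hz⟩ := hs' (R' k)
    have hzk : (z : Y) = k := hinj hz
    exact Submodule.disjoint_def.1 hc.disjoint k hk (hzk ▸ z.2)

/-- Let `V` be the intersection of the ranges of all powers. `S` maps `V` onto `V` with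
finite-dimensional kernel, so `S - w` is onto on `V` for small `w`; finite ascent of `S - w` makes
it injective there, and hence `S` is injective on `V`. As `ker S ∩ range (S ^ n₀)` lies in `V` for
large `n₀`, the ascent is at most `n₀`. -/
lemma IsUpperSemiFredholm.ascent_lt_top {S : Y →L[ℂ] Y} (h : IsUpperSemiFredholm S)
    (hw : ∀ ε > 0, ∃ w : ℂ, ‖w‖ < ε ∧ ascent (S - w • (1 : Y →L[ℂ] Y)) < ⊤) :
    ascent S < ⊤ := by
  have hanti : ∀ n m : ℕ, n ≤ m → (S ^ m).range ≤ (S ^ n).range := by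
    rintro n m hnm _ ⟨x, rfl⟩
    obtain ⟨k, rfl⟩ := Nat.exists_eq_add_of_le hnm
    exact ⟨(S ^ k) x, by rw [pow_add]; rfl⟩
  have hfin := nullity_lt_top.1 h.2
  obtain ⟨n₀, hn₀⟩ : ∃ n₀, ∀ m, n₀ ≤ m → ∀ x, S x = 0 → x ∈ (S ^ n₀).range → x ∈ (S ^ m).range := by
    obtain ⟨n₀, hn₀⟩ := IsArtinian.monotone_stabilizes
      (⟨fun n ↦ OrderDual.toDual ((S ^ n).range.comap S.ker.subtype),
        fun n m hnm ↦ Submodule.comap_mono (hanti n m hnm)⟩ : ℕ →o (Submodule ℂ S.ker)ᵒᵈ)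
    refine ⟨n₀, fun m hm x hx hxn ↦ ?_⟩
    have h1 : (S ^ n₀).range.comap S.ker.subtype = (S ^ m).range.comap S.ker.subtype := hn₀ m hm
    have h2 : (⟨x, hx⟩ : S.ker) ∈ (S ^ n₀).range.comap S.ker.subtype := hxn
    rw [h1] at h2
    exact h2
  set V : Submodule ℂ Y := ⨅ n, (S ^ n).range with hV
  have hVclosed : IsClosed (V : Set Y) := by
    rw [hV, Submodule.coe_iInf]
    exact isClosed_iInter h.isClosed_range_pow
  have hVcomp : CompleteSpace V := hVclosed.completeSpace_coe
  have hVmem : ∀ x, (∀ m, n₀ ≤ m → x ∈ (S ^ m).range) → x ∈ V := by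
    intro x hx
    rw [hV, Submodule.mem_iInf]
    intro n
    exact hanti n (max n n₀) (le_max_left _ _) (hx _ (le_max_right _ _))
  have hinv : ∀ x ∈ V, S x ∈ V := by
    intro x hx
    rw [hV, Submodule.mem_iInf] at hx ⊢
    intro n
    obtain ⟨y, hy⟩ := hx n
    have hy : (S ^ n) y = x := hy
    refine ⟨S y, ?_⟩
    change (S ^ n) (S y) = S x
    rw [← hy, ← pow_succ_apply, ← pow_succ_apply']
  have hsurj : Function.Surjective (S.restrict hinv) := by
    rintro ⟨x, hx⟩
    rw [hV, Submodule.mem_iInf] at hx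
    have hx' : ∀ m, ∃ y, (S ^ (m + 1)) y = x := fun m ↦ hx (m + 1)
    obtain ⟨y, hy⟩ := hx' n₀
    rw [pow_succ_apply'] at hy
    refine ⟨⟨(S ^ n₀) y, hVmem _ fun m hm ↦ ?_⟩, Subtype.ext hy⟩
    obtain ⟨z, hz⟩ := hx' m
    rw [pow_succ_apply'] at hz
    -- Two preimages of `x` differ by an element of `ker S ∩ range (S ^ n₀)`, which lies in every
    -- later range; so one preimage serves all `m`.
    have hd := hn₀ m hm ((S ^ n₀) y - (S ^ m) z) (by rw [map_sub, hy, hz, sub_self])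
      (sub_mem ⟨y, rfl⟩ (hanti n₀ m hm ⟨z, rfl⟩))
    have := add_mem hd (⟨z, rfl⟩ : (S ^ m) z ∈ (S ^ m).range)
    simpa using this
  have hnull : nullity (S.restrict hinv) < ⊤ := by
    rw [nullity_lt_top]
    let j : (S.restrict hinv).ker →ₗ[ℂ] S.ker :=
      { toFun := fun x ↦ ⟨x.1.1, congrArg (fun z : V ↦ (z : Y)) x.2⟩
        map_add' := fun _ _ ↦ rfl
        map_smul' := fun _ _ ↦ rfl }
    refine FiniteDimensional.of_injective j fun x y hxy ↦ ?_
    exact Subtype.ext (Subtype.ext (congrArg (fun z : S.ker ↦ (z : Y)) hxy))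
  obtain ⟨ε, hε, H⟩ := exists_perturbation_surjective_injective hsurj hnull
  obtain ⟨w, hwε, hasc⟩ := hw ε hε
  obtain ⟨hs, hi⟩ := H (S.restrict hinv - w • (1 : V →L[ℂ] V)) (by
    rw [sub_sub_cancel_left, norm_neg]
    refine lt_of_le_of_lt ?_ hwε
    rw [norm_smul]
    exact mul_le_of_le_one_right (norm_nonneg _) ContinuousLinearMap.norm_id_le)
  have hinj : Function.Injective (S.restrict hinv) := by
    refine hi ((injective_iff_map_eq_zero _).2 fun x hx ↦ Subtype.ext ?_)
    refine eq_zero_of_ascent_lt_top hasc (V := V) (fun u hu ↦ ?_) x.2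
      (congrArg (fun z : V ↦ (z : Y)) hx)
    obtain ⟨v, hv⟩ := hs ⟨u, hu⟩
    exact ⟨v, v.2, congrArg (fun z : V ↦ (z : Y)) hv⟩
  refine GzSpectral.ascent_lt_top.2 ⟨n₀, fun x hx ↦ ?_⟩
  rw [pow_succ_apply'] at hx
  have hmem : (S ^ n₀) x ∈ V := hVmem _ fun m hm ↦ hn₀ m hm _ hx ⟨x, rfl⟩
  have := (injective_iff_map_eq_zero _).1 hinj ⟨_, hmem⟩ (Subtype.ext hx)
  exact congrArg (fun z : V ↦ (z : Y)) this

end PuncturedAscent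

/-! ### Restrictions to summands and iterated decompositions -/

section Reduction

variable {Y : Type*} [NormedAddCommGroup Y] [NormedSpace ℂ Y]

lemma coe_restrict_pow {S : Y →L[ℂ] Y} {M : Submodule ℂ Y} (h : ∀ x ∈ M, S x ∈ M) (n : ℕ) (x : M) :
    (((S.restrict h) ^ n) x : Y) = (S ^ n) x := by
  induction n with
  | zero => rfl
  | succ n ih => rw [pow_succ_apply', pow_succ_apply', ← ih]; rfl

lemma ascent_restrict_lt_top {S : Y →L[ℂ] Y} {M : Submodule ℂ Y} (h : ∀ x ∈ M, S x ∈ M)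
    (hS : ascent S < ⊤) : ascent (S.restrict h) < ⊤ := by
  obtain ⟨n, hn⟩ := ascent_lt_top.1 hS
  refine ascent_lt_top.2 ⟨n, fun x hx ↦ Subtype.ext ?_⟩
  rw [coe_restrict_pow]
  refine hn _ ?_
  rw [← coe_restrict_pow h, hx]
  rfl

lemma IsRed.trans {S : Y →L[ℂ] Y} {M N : Submodule ℂ Y} (h : IsRed S M N) {M₁ M₂ : Submodule ℂ M}
    (h' : IsRed (S.restrict h.invariant_left) M₁ M₂) [FiniteDimensional ℂ M₂] :
    IsRed S (M₁.map M.subtype) (M₂.map M.subtype ⊔ N) where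
  isClosed_left := by
    rw [Submodule.map_coe]
    exact h.isClosed_left.isClosedEmbedding_subtypeVal.isClosedMap _ h'.isClosed_left
  isClosed_right := by
    rw [sup_comm]
    exact Submodule.isClosed_sup_finiteDimensional _ _ h.isClosed_right
  invariant_left := by
    rintro _ ⟨x, hx, rfl⟩
    exact ⟨_, h'.invariant_left x hx, rfl⟩
  invariant_right := by
    intro x hx
    obtain ⟨_, ⟨y, hy, rfl⟩, n, hn, rfl⟩ := Submodule.mem_sup.1 hx
    rw [map_add]
    exact add_mem (Submodule.mem_sup_left ⟨_, h'.invariant_right y hy, rfl⟩)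
      (Submodule.mem_sup_right (h.invariant_right n hn))
  isCompl := by
    constructor
    · rw [Submodule.disjoint_def]
      rintro _ ⟨x, hx, rfl⟩ hx'
      obtain ⟨_, ⟨y, hy, rfl⟩, n, hn, hyn⟩ := Submodule.mem_sup.1 hx'
      have h1 : n = ((x - y : M) : Y) := by
        rw [eq_comm, Submodule.coe_sub, sub_eq_iff_eq_add, add_comm]
        exact hyn.symm
      have h2 : n = 0 := Submodule.disjoint_def.1 h.isCompl.disjoint n (h1 ▸ (x - y).2) hn
      have h3 : x = y := by
        rw [h2] at h1
        exact sub_eq_zero.1 (Subtype.ext h1.symm)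
      have h4 : x = 0 := Submodule.disjoint_def.1 h'.isCompl.disjoint x hx (h3 ▸ hy)
      simp [h4]
    · rw [codisjoint_iff, ← sup_assoc, ← Submodule.map_sup, h'.isCompl.sup_eq_top,
        Submodule.map_top, Submodule.range_subtype, h.isCompl.sup_eq_top]

lemma IsUpperSemiFredholm.restrict [CompleteSpace Y] {S : Y →L[ℂ] Y} (hS : IsUpperSemiFredholm S)
    {M : Submodule ℂ Y} (hM : IsClosed (M : Set Y)) (h : ∀ x ∈ M, S x ∈ M) :
    IsUpperSemiFredholm (S.restrict h) ∧ Module.finrank ℂ (S.restrict h).ker =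
      Module.finrank ℂ (S.ker ⊓ M : Submodule ℂ Y) := by
  have hfin := nullity_lt_top.1 hS.2
  have hker : (S.restrict h).ker.map M.subtype = S.ker ⊓ M := by
    ext x
    constructor
    · rintro ⟨y, hy, rfl⟩
      exact ⟨congrArg (fun z : M ↦ (z : Y)) hy, y.2⟩
    · rintro ⟨hx, hxM⟩
      exact ⟨⟨x, hxM⟩, Subtype.ext hx, rfl⟩
  have e := Submodule.equivMapOfInjective M.subtype M.injective_subtype (S.restrict h).ker
  rw [hker] at e
  refine ⟨⟨?_, ?_⟩, e.finrank_eq⟩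
  · have hr : ((S.restrict h).range : Set M) =
        (Subtype.val : M → Y) ⁻¹' (M.map S.toLinearMap : Set Y) := by
      ext x
      constructor
      · rintro ⟨y, rfl⟩
        exact ⟨y, y.2, rfl⟩
      · rintro ⟨y, hy, hyx⟩
        exact ⟨⟨y, hy⟩, Subtype.ext hyx⟩
    rw [hr]
    exact (hS.isClosed_map hM).preimage continuous_subtype_val
  · rw [nullity_lt_top]
    exact e.symm.finiteDimensional

end Reduction

/-! ### Splitting off the nilpotent part -/

section FiniteAscent

/-- A Jordan block of maximal length in the finite-dimensional nilpotent part splits off. -/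
lemma exists_isRed_jordan_block {Y : Type*} [NormedAddCommGroup Y] [NormedSpace ℂ Y]
    [CompleteSpace Y] {S : Y →L[ℂ] Y} (hS : IsUpperSemiFredholm S) (ha : ascent S < ⊤)
    (hi : ¬ Function.Injective S) :
    ∃ C B : Submodule ℂ Y, IsRed S C B ∧ FiniteDimensional ℂ B ∧ S.ker ⊓ C < S.ker := by
  classical
  have hex := ascent_lt_top.1 ha
  -- The ascent is `q + 1`, positive because `S` is not injective.
  obtain ⟨q, hq⟩ : ∃ q, Nat.find hex = q + 1 := by
    refine Nat.exists_eq_succ_of_ne_zero fun h0 ↦ hi ?_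
    have := Nat.find_spec hex
    rw [h0] at this
    exact (injective_iff_map_eq_zero _).2 fun x hx ↦ this x (by simpa using hx)
  have hp : ∀ x, (S ^ (q + 1 + 1)) x = 0 → (S ^ (q + 1)) x = 0 := hq ▸ Nat.find_spec hex
  have hmin := Nat.find_min hex (m := q) (by omega)
  push Not at hmin
  obtain ⟨y, hy, hy'⟩ := hmin
  have hnot : (S ^ q) y ∉ (S ^ (q + 1)).range := by
    rintro ⟨u, hu⟩
    have hu : (S ^ (q + 1)) u = (S ^ q) y := hu
    refine hy' (hu ▸ hp u ?_)
    rw [pow_succ_apply', hu, ← pow_succ_apply', hy]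
  obtain ⟨f, hf0, hf⟩ : ∃ f : Y →L[ℂ] ℂ, (∀ x, f ((S ^ (q + 1)) x) = 0) ∧ f ((S ^ q) y) ≠ 0 := by
    have : IsClosed ((S ^ (q + 1)).range : Set Y) := hS.isClosed_range_pow (q + 1)
    have hne : (S ^ (q + 1)).range.mkQ ((S ^ q) y) ≠ 0 := by simpa using hnot
    obtain ⟨g, hg⟩ := SeparatingDual.exists_ne_zero (R := ℂ) hne
    refine ⟨g ∘L (S ^ (q + 1)).range.mkQL, fun x ↦ ?_, hg⟩
    have : (S ^ (q + 1)).range.mkQ ((S ^ (q + 1)) x) = 0 :=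
      (Submodule.Quotient.mk_eq_zero _).2 ⟨x, rfl⟩
    exact (congrArg g this).trans (map_zero g)
  have hf0' : ∀ n, q < n → ∀ x, f ((S ^ n) x) = 0 := by
    intro n hn x
    obtain ⟨k, rfl⟩ := Nat.exists_eq_add_of_le (Nat.succ_le_of_lt hn)
    rw [pow_add]
    exact hf0 _
  let Φ : (Fin (q + 1) → ℂ) →ₗ[ℂ] Y :=
    Fintype.linearCombination ℂ fun i : Fin (q + 1) ↦ (S ^ (i : ℕ)) y
  have hΦ : ∀ c, Φ c = ∑ i : Fin (q + 1), c i • (S ^ (i : ℕ)) y := fun c ↦ rfl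
  let Ψ : Y →ₗ[ℂ] (Fin (q + 1) → ℂ) := LinearMap.pi fun i ↦ (f ∘L (S ^ (i : ℕ))).toLinearMap
  have hΨ : ∀ x i, Ψ x i = f ((S ^ (i : ℕ)) x) := fun x i ↦ rfl
  -- The matrix `f (S ^ (i + j) y)` vanishes for `i + j > q` and is nonzero for `i + j = q`. It is
  -- anti-triangular, and row `q - j` determines `c j` from the earlier coefficients.
  have hinj : Function.Injective (Ψ ∘ₗ Φ) := by
    refine (injective_iff_map_eq_zero _).2 fun c hc ↦ ?_
    have key : ∀ j : ℕ, ∀ hj : j < q + 1, c ⟨j, hj⟩ = 0 := by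
      intro j
      induction j using Nat.strong_induction_on with
      | _ j ih =>
        intro hj
        have h1 : Ψ (Φ c) ⟨q - j, by omega⟩ = 0 := congrFun hc _
        rw [hΨ, hΦ, map_sum, map_sum, Finset.sum_eq_single ⟨j, hj⟩] at h1
        · rw [map_smul, map_smul, ← mul_apply_eq_comp, ← pow_add, smul_eq_mul,
            Nat.sub_add_cancel (by omega)] at h1
          exact (mul_eq_zero.1 h1).resolve_right hf
        · rintro ⟨i, hi⟩ - hij
          rw [map_smul, map_smul, ← mul_apply_eq_comp, ← pow_add]
          rcases lt_or_gt_of_ne (fun h ↦ hij (Fin.ext h) : i ≠ j) with h | h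
          · rw [ih i h hi, zero_smul]
          · change c _ • f ((S ^ (q - j + i)) y) = 0
            rw [hf0' _ (by omega), smul_zero]
        · simp
    ext ⟨j, hj⟩
    exact key j hj
  have hsurj : Function.Surjective (Ψ ∘ₗ Φ) := LinearMap.injective_iff_surjective.1 hinj
  have hcompl : IsCompl Ψ.ker Φ.range := by
    constructor
    · rw [Submodule.disjoint_def]
      rintro _ hx ⟨c, rfl⟩
      have : c = 0 := (injective_iff_map_eq_zero _).1 hinj c hx
      simp [this]
    · rw [codisjoint_iff, eq_top_iff]
      intro x _
      obtain ⟨c, hc⟩ := hsurj (Ψ x)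
      have hc : Ψ (Φ c) = Ψ x := hc
      refine Submodule.mem_sup.2 ⟨x - Φ c, ?_, Φ c, ⟨c, rfl⟩, sub_add_cancel _ _⟩
      rw [LinearMap.mem_ker, map_sub, hc, sub_self]
  have hfin : FiniteDimensional ℂ Φ.range := inferInstance
  have hmemC : ∀ x, x ∈ Ψ.ker ↔ ∀ i, i ≤ q → f ((S ^ i) x) = 0 := by
    intro x
    rw [LinearMap.mem_ker, funext_iff]
    exact ⟨fun h i hi ↦ h ⟨i, by omega⟩, fun h i ↦ h i (by omega)⟩
  refine ⟨Ψ.ker, Φ.range, ⟨?_, Submodule.closed_of_finiteDimensional _, ?_, ?_, hcompl⟩, hfin, ?_⟩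
  · have : (Ψ.ker : Set Y) = ⋂ i : Fin (q + 1), (f ∘L (S ^ (i : ℕ))) ⁻¹' {0} := by
      ext x
      simp only [SetLike.mem_coe, LinearMap.mem_ker, funext_iff, hΨ, Set.mem_iInter]
      rfl
    rw [this]
    exact isClosed_iInter fun i ↦ isClosed_singleton.preimage (f ∘L (S ^ (i : ℕ))).continuous
  · intro x hx
    rw [hmemC] at hx ⊢
    intro i hi
    rw [← pow_succ_apply]
    rcases hi.lt_or_eq with h | rfl
    · exact hx _ h
    · exact hf0 x
  · rintro _ ⟨c, rfl⟩
    rw [hΦ, map_sum]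
    refine sum_mem fun i _ ↦ ?_
    rw [map_smul, ← pow_succ_apply']
    refine Submodule.smul_mem _ _ ?_
    by_cases h : (i : ℕ) + 1 < q + 1
    · exact ⟨Pi.single ⟨i + 1, h⟩ 1, by simp [Φ]⟩
    · have : (i : ℕ) + 1 = q + 1 := by omega
      rw [this, hy]
      exact zero_mem _
  -- `S ^ q y` is in `ker S` but not in `ker Ψ`, since `f` does not vanish on it.
  · refine lt_of_le_of_ne inf_le_left fun h ↦ ?_
    have hk : (S ^ q) y ∈ S.ker := by
      change S ((S ^ q) y) = 0
      rw [← pow_succ_apply', hy]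
    rw [← h] at hk
    exact hf (by simpa using (hmemC _).1 hk.2 0 (Nat.zero_le q))

/-- Each Jordan block split off lowers the dimension of the kernel on the remaining summand, so the
induction runs on that dimension with the space varying. -/
lemma IsUpperSemiFredholm.exists_isRed {Y : Type*} [NormedAddCommGroup Y] [NormedSpace ℂ Y]
    [CompleteSpace Y] {S : Y →L[ℂ] Y} (hS : IsUpperSemiFredholm S) (ha : ascent S < ⊤) :
    ∃ M N : Submodule ℂ Y, IsRed S M N ∧ FiniteDimensional ℂ N ∧ Disjoint M S.ker := by
  induction hn : Module.finrank ℂ S.ker using Nat.strong_induction_on generalizing Y with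
  | _ n ih =>
    by_cases hi : Function.Injective S
    · refine ⟨⊤, ⊥, ⟨isClosed_univ, isClosed_singleton, fun _ _ ↦ trivial, ?_, isCompl_top_bot⟩,
        inferInstance, ?_⟩
      · rintro x hx
        rw [Submodule.mem_bot] at hx ⊢
        rw [hx, map_zero]
      · rw [LinearMap.ker_eq_bot.2 hi]
        exact disjoint_bot_right
    · obtain ⟨C, B, hCB, hB, hlt⟩ := exists_isRed_jordan_block hS ha hi
      have : CompleteSpace C := hCB.isClosed_left.completeSpace_coe
      have hfin := nullity_lt_top.1 hS.2
      obtain ⟨hSC, hker⟩ := hS.restrict hCB.isClosed_left hCB.invariant_left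
      have hrank := Submodule.finrank_lt_finrank_of_lt hlt
      obtain ⟨M, N, hMN, hN, hd⟩ := ih _ (by rw [← hn, hker]; exact hrank) hSC
        (ascent_restrict_lt_top _ ha) rfl
      refine ⟨_, _, hCB.trans hMN, inferInstance, ?_⟩
      rw [Submodule.disjoint_def]
      rintro _ ⟨x, hx, rfl⟩ hx0
      rw [Submodule.disjoint_def.1 hd x hx (Subtype.ext hx0), map_zero]

end FiniteAscent

/-! ### Zeroloid operators -/

section Zeroloid

/-- Otherwise `A` contains a ball about `0` and accumulates at `ε / 2 ≠ 0`. The point found may be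
`0` itself. -/
lemma exists_small_notMem_of_derivedSet_subset {A : Set ℂ} (hA : derivedSet A ⊆ {0}) {ε : ℝ}
    (hε : 0 < ε) : ∃ w : ℂ, ‖w‖ < ε ∧ w ∉ A := by
  by_contra! H
  have hmem : ((ε / 2 : ℝ) : ℂ) ∈ derivedSet A := by
    have hnhds : A ∈ nhds ((ε / 2 : ℝ) : ℂ) := by
      refine Filter.mem_of_superset (Metric.isOpen_ball.mem_nhds ?_)
        (fun w hw ↦ H w (mem_ball_zero_iff.1 hw))
      rw [mem_ball_zero_iff, Complex.norm_real, Real.norm_eq_abs, abs_of_pos (by linarith)]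
      linarith
    rw [mem_derivedSet, accPt_iff_frequently_nhdsNE]
    exact (Filter.Eventually.frequently (mem_nhdsWithin_of_mem_nhds hnhds))
  have := hA hmem
  rw [Set.mem_singleton_iff, Complex.ofReal_eq_zero] at this
  linarith

variable {Y : Type*} [NormedAddCommGroup Y] [NormedSpace ℂ Y]

lemma notMem_spectrum_iff [CompleteSpace Y] {S : Y →L[ℂ] Y} {w : ℂ} :
    w ∉ spectrum ℂ S ↔ Function.Bijective (S - w • (1 : Y →L[ℂ] Y)) := by
  rw [spectrum.notMem_iff, ← IsUnit.neg_iff, neg_sub, Algebra.algebraMap_eq_smul_one,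
    ContinuousLinearMap.isUnit_iff_bijective]

lemma isZeroloid_of_finiteDimensional [FiniteDimensional ℂ Y] (S : Y →L[ℂ] Y) : IsZeroloid S := by
  have : CompleteSpace Y := FiniteDimensional.complete ℂ Y
  have hfin : (spectrum ℂ S).Finite := by
    rw [ContinuousLinearMap.spectrum_eq]
    exact Module.End.finite_spectrum _
  intro x hx
  exact absurd hfin (Set.Infinite.of_accPt hx)

lemma IsZeroloid.sup [CompleteSpace Y] {S : Y →L[ℂ] Y} {A B : Submodule ℂ Y}
    (hA : IsClosed (A : Set Y)) (hB : IsClosed (B : Set Y))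
    (hAB : IsClosed ((A ⊔ B : Submodule ℂ Y) : Set Y))
    (hd : Disjoint A B) (iA : ∀ x ∈ A, S x ∈ A) (iB : ∀ x ∈ B, S x ∈ B)
    (iAB : ∀ x ∈ A ⊔ B, S x ∈ A ⊔ B) (zA : IsZeroloid (S.restrict iA))
    (zB : IsZeroloid (S.restrict iB)) : IsZeroloid (S.restrict iAB) := by
  have := hA.completeSpace_coe
  have := hB.completeSpace_coe
  have := hAB.completeSpace_coe
  have hsub : spectrum ℂ (S.restrict iAB) ⊆
      spectrum ℂ (S.restrict iA) ∪ spectrum ℂ (S.restrict iB) := by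
    intro w
    contrapose
    rw [Set.mem_union, not_or, notMem_spectrum_iff, notMem_spectrum_iff, notMem_spectrum_iff]
    rintro ⟨⟨injA, surjA⟩, injB, surjB⟩
    constructor
    · refine (injective_iff_map_eq_zero _).2 fun ⟨x, hx⟩ h0 ↦ Subtype.ext ?_
      obtain ⟨a, ha, b, hb, rfl⟩ := Submodule.mem_sup.1 hx
      have h0 : S (a + b) - w • (a + b) = 0 :=
        congrArg (fun z : (A ⊔ B : Submodule ℂ Y) ↦ (z : Y)) h0
      have h1 : S a - w • a = -(S b - w • b) := by
        rw [map_add, smul_add] at h0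
        rw [eq_neg_iff_add_eq_zero, ← h0]
        abel
      have hmA : S a - w • a ∈ A := sub_mem (iA a ha) (A.smul_mem w ha)
      have hmB : S b - w • b ∈ B := sub_mem (iB b hb) (B.smul_mem w hb)
      have h2 : S a - w • a = 0 :=
        Submodule.disjoint_def.1 hd _ hmA (h1 ▸ neg_mem hmB)
      have h3 : S b - w • b = 0 := by rwa [h2, eq_comm, neg_eq_zero] at h1
      have ha0 := (injective_iff_map_eq_zero _).1 injA ⟨a, ha⟩ (Subtype.ext h2)
      have hb0 := (injective_iff_map_eq_zero _).1 injB ⟨b, hb⟩ (Subtype.ext h3)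
      have ha0 : a = 0 := congrArg (fun z : A ↦ (z : Y)) ha0
      have hb0 : b = 0 := congrArg (fun z : B ↦ (z : Y)) hb0
      simp [ha0, hb0]
    · rintro ⟨x, hx⟩
      obtain ⟨a, ha, b, hb, rfl⟩ := Submodule.mem_sup.1 hx
      obtain ⟨⟨a', ha'⟩, h1⟩ := surjA ⟨a, ha⟩
      obtain ⟨⟨b', hb'⟩, h2⟩ := surjB ⟨b, hb⟩
      have h1 : S a' - w • a' = a := congrArg (fun z : A ↦ (z : Y)) h1
      have h2 : S b' - w • b' = b := congrArg (fun z : B ↦ (z : Y)) h2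
      refine ⟨⟨a' + b', Submodule.add_mem_sup ha' hb'⟩, Subtype.ext ?_⟩
      change S (a' + b') - w • (a' + b') = a + b
      rw [← h1, ← h2, map_add, smul_add]
      abel
  refine (derivedSet_mono _ _ hsub).trans ?_
  rw [derivedSet_union]
  exact Set.union_subset zA zB

end Zeroloid

/-! ### Transfer of invariants to one summand when the other is invertible -/

section Transfer

variable {Y : Type*} [NormedAddCommGroup Y] [NormedSpace ℂ Y] {S : Y →L[ℂ] Y}
  {M N : Submodule ℂ Y}

lemma IsRed.sub_smul (h : IsRed S M N) (w : ℂ) : IsRed (S - w • (1 : Y →L[ℂ] Y)) M N where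
  isClosed_left := h.isClosed_left
  isClosed_right := h.isClosed_right
  invariant_left x hx := sub_mem (h.invariant_left x hx) (M.smul_mem w hx)
  invariant_right x hx := sub_mem (h.invariant_right x hx) (N.smul_mem w hx)
  isCompl := h.isCompl

lemma IsRed.exists_add (h : IsRed S M N) (x : Y) : ∃ m ∈ M, ∃ n ∈ N, m + n = x :=
  Submodule.mem_sup.1 (h.isCompl.sup_eq_top ▸ Submodule.mem_top)

lemma IsRed.eq_of_add_eq (h : IsRed S M N) {m m' n n' : Y} (hm : m ∈ M) (hm' : m' ∈ M)
    (hn : n ∈ N) (hn' : n' ∈ N) (he : m + n = m' + n') : m = m' ∧ n = n' := by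
  have h1 : m - m' = n' - n := by
    rw [sub_eq_sub_iff_add_eq_add, he, add_comm]
  have h2 : m - m' = 0 :=
    Submodule.disjoint_def.1 h.isCompl.disjoint _ (sub_mem hm hm') (h1 ▸ sub_mem hn' hn)
  rw [h2, eq_comm] at h1
  exact ⟨sub_eq_zero.1 h2, (sub_eq_zero.1 h1).symm⟩

lemma IsRed.nullity_eq (h : IsRed S M N) (hN : Function.Injective (S.restrict h.invariant_right)) :
    nullity S = nullity (S.restrict h.invariant_left) := by
  have hker : (S.restrict h.invariant_left).ker.map M.subtype = S.ker := by
    ext x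
    constructor
    · rintro ⟨y, hy, rfl⟩
      exact congrArg (fun z : M ↦ (z : Y)) hy
    · intro hx
      have hx : S x = 0 := hx
      obtain ⟨m, hm, n, hn, rfl⟩ := h.exists_add x
      obtain ⟨h1, h2⟩ := h.eq_of_add_eq (h.invariant_left m hm) M.zero_mem
        (h.invariant_right n hn) N.zero_mem (by rw [← map_add, hx, add_zero])
      have hn0 := (injective_iff_map_eq_zero _).1 hN ⟨n, hn⟩ (Subtype.ext h2)
      have hn0 : n = 0 := congrArg (fun z : N ↦ (z : Y)) hn0
      exact ⟨⟨m, hm⟩, Subtype.ext h1, by simp [hn0]⟩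
  have e := Submodule.equivMapOfInjective M.subtype M.injective_subtype
    (S.restrict h.invariant_left).ker
  rw [hker] at e
  rw [nullity, nullity, e.rank_eq]

/-- The range of `S` is that of its left part plus all of `N`; the defect and closed-range transfers
both rest on this. -/
lemma IsRed.mem_range_iff (h : IsRed S M N)
    (hN : Function.Surjective (S.restrict h.invariant_right)) {m n : Y} (hm : m ∈ M) (hn : n ∈ N) :
    m + n ∈ S.range ↔ (⟨m, hm⟩ : M) ∈ (S.restrict h.invariant_left).range := by
  constructor
  · rintro ⟨x, hx⟩
    have hx : S x = m + n := hx
    obtain ⟨a, ha, b, hb, rfl⟩ := h.exists_add x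
    rw [map_add] at hx
    exact ⟨⟨a, ha⟩, Subtype.ext (h.eq_of_add_eq (h.invariant_left a ha) hm
      (h.invariant_right b hb) hn hx).1⟩
  · rintro ⟨a, ha⟩
    obtain ⟨b, hb⟩ := hN ⟨n, hn⟩
    have ha : S a = m := congrArg (fun z : M ↦ (z : Y)) ha
    have hb : S b = n := congrArg (fun z : N ↦ (z : Y)) hb
    exact ⟨a + b, by rw [map_add]; exact congrArg₂ _ ha hb⟩

lemma IsRed.defect_eq (h : IsRed S M N)
    (hN : Function.Surjective (S.restrict h.invariant_right)) :
    defect S = defect (S.restrict h.invariant_left) := by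
  let φ : M →ₗ[ℂ] Y ⧸ S.range := S.range.mkQ ∘ₗ M.subtype
  have hker : φ.ker = (S.restrict h.invariant_left).range := by
    ext ⟨m, hm⟩
    rw [← h.mem_range_iff hN hm N.zero_mem, add_zero, LinearMap.mem_ker]
    exact Submodule.Quotient.mk_eq_zero _
  have hsurj : Function.Surjective φ := by
    intro y
    obtain ⟨y, rfl⟩ := S.range.mkQ_surjective y
    obtain ⟨m, hm, n, hn, rfl⟩ := h.exists_add y
    refine ⟨⟨m, hm⟩, ?_⟩
    change S.range.mkQ m = S.range.mkQ (m + n)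
    rw [map_add, left_eq_add]
    refine (Submodule.Quotient.mk_eq_zero _).2 ?_
    have := (h.mem_range_iff hN M.zero_mem hn).2 (zero_mem _)
    rwa [zero_add] at this
  have e := (Submodule.quotEquivOfEq _ _ hker.symm).trans (φ.quotKerEquivOfSurjective hsurj)
  rw [defect, defect, e.rank_eq]

lemma IsRed.isClosed_range_iff [CompleteSpace Y] (h : IsRed S M N)
    (hN : Function.Surjective (S.restrict h.invariant_right)) :
    IsClosed (S.range : Set Y) ↔ IsClosed ((S.restrict h.invariant_left).range : Set M) := by
  have htop := Submodule.IsCompl.isTopCompl_of_isClosed h.isCompl h.isClosed_left h.isClosed_right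
  constructor
  · intro hc
    convert hc.preimage (M.subtypeL.continuous) using 1
    ext ⟨m, hm⟩
    have := h.mem_range_iff hN hm N.zero_mem
    rw [add_zero] at this
    exact this.symm
  · intro hc
    convert hc.preimage (M.projectionOntoL N htop).continuous using 1
    ext x
    obtain ⟨m, hm, n, hn, rfl⟩ := h.exists_add x
    have h1 : M.projectionOntoL N htop (m + n) = ⟨m, hm⟩ := by
      rw [map_add, Submodule.projectionOntoL_apply_left htop ⟨m, hm⟩,
        Submodule.projectionOntoL_apply_right htop ⟨n, hn⟩, add_zero]
    rw [Set.mem_preimage, h1]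
    exact h.mem_range_iff hN hm hn

lemma IsRed.isUpperSemiFredholm_iff [CompleteSpace Y] (h : IsRed S M N)
    (hN : Function.Bijective (S.restrict h.invariant_right)) :
    IsUpperSemiFredholm S ↔ IsUpperSemiFredholm (S.restrict h.invariant_left) := by
  rw [IsUpperSemiFredholm, IsUpperSemiFredholm, h.isClosed_range_iff hN.2, h.nullity_eq hN.1]

end Transfer

/-! ### Weyl and Browder operators through decompositions -/

section Criteria

variable {Y : Type*} [NormedAddCommGroup Y] [NormedSpace ℂ Y]

lemma norm_sub_smul_one_sub_le (S : Y →L[ℂ] Y) (w : ℂ) :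
    ‖S - w • (1 : Y →L[ℂ] Y) - S‖ ≤ ‖w‖ := by
  rw [sub_sub_cancel_left, norm_neg, norm_smul]
  exact mul_le_of_le_one_right (norm_nonneg _) ContinuousLinearMap.norm_id_le

/-- The kernel of `R` may lack a closed complement, so a bounded nonlinear right inverse and
successive approximation replace the bijective restriction. -/
lemma exists_perturbation_surjective [CompleteSpace Y] {R : Y →L[ℂ] Y}
    (hs : Function.Surjective R) :
    ∃ ε > 0, ∀ R' : Y →L[ℂ] Y, ‖R' - R‖ < ε → Function.Surjective R' := by
  obtain ⟨g, hg⟩ := R.exists_nonlinearRightInverse_of_surjective (LinearMap.range_eq_top.2 hs)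
  refine ⟨(g.nnnorm : ℝ)⁻¹, by positivity, fun R' hR' y ↦ ?_⟩
  have happ : ApproximatesLinearOn R' R Set.univ ‖R' - R‖₊ := by
    intro x _ z _
    have : R' x - R' z - R (x - z) = (R' - R) (x - z) := by simp
    rw [this]
    exact (R' - R).le_opNorm _
  have hδ : 0 < (g.nnnorm : ℝ)⁻¹ - ‖R' - R‖₊ := sub_pos.2 hR'
  -- The radius is chosen so that the ball covered in the target has radius exactly `‖y‖`.
  have h := happ.surjOn_closedBall_of_nonlinearRightInverse g (b := 0)
    (ε := ‖y‖ / ((g.nnnorm : ℝ)⁻¹ - ‖R' - R‖₊)) (by positivity) (Set.subset_univ _)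
  obtain ⟨x, -, hx⟩ := h (show y ∈ _ by
    rw [mem_closedBall_iff_norm, map_zero, sub_zero, mul_div_cancel₀ _ hδ.ne'])
  exact ⟨x, hx⟩

lemma isBoundedBelow_iff {S : Y →L[ℂ] Y} :
    IsBoundedBelow S ↔ IsClosed (S.range : Set Y) ∧ Function.Injective S := by
  rw [IsBoundedBelow, IsUpperSemiFredholm, nullity_eq_zero]
  refine ⟨fun h ↦ ⟨h.1.1, h.2⟩, fun h ↦ ⟨⟨h.1, ?_⟩, h.2⟩⟩
  rw [nullity_eq_zero.2 h.2]
  exact ENat.top_pos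

lemma IsBoundedBelow.isSemiRegular {S : Y →L[ℂ] Y} (h : IsBoundedBelow S) : IsSemiRegular S := by
  obtain ⟨hc, hi⟩ := isBoundedBelow_iff.1 h
  refine ⟨hc, fun n ↦ ?_⟩
  rw [LinearMap.ker_eq_bot.2 hi]
  exact bot_le

lemma ascent_lt_top_of_injective {S : Y →L[ℂ] Y} (h : Function.Injective S) : ascent S < ⊤ :=
  ascent_lt_top.2 ⟨0, fun x hx ↦ (injective_iff_map_eq_zero _).1 h x (by simpa using hx)⟩

lemma isUpperSemiWeyl_iff {S : Y →L[ℂ] Y} :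
    IsUpperSemiWeyl S ↔ IsUpperSemiFredholm S ∧ nullity S ≤ defect S := by
  rw [IsUpperSemiWeyl, ind_nonpos_iff]

lemma isWeyl_iff [CompleteSpace Y] {S : Y →L[ℂ] Y} :
    IsWeyl S ↔ IsUpperSemiFredholm S ∧ defect S < ⊤ ∧ nullity S = defect S := by
  rw [IsWeyl, isFredholm_iff, ind_eq_zero_iff]
  exact ⟨fun h ↦ ⟨h.1.1, h.1.2, h.2.1⟩, fun h ↦ ⟨⟨h.1, h.2.1⟩, h.2.2, h.1.2⟩⟩

lemma eq_of_codim_eq {Z W : Submodule ℂ Y} (hle : Z ≤ W) (h : codim Z = codim W)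
    (hW : codim W < ⊤) : Z = W := by
  have := codim_lt_top.1 hW
  have := codim_lt_top.1 (h ▸ hW)
  have hrank : Module.finrank ℂ (Y ⧸ Z) = Module.finrank ℂ (Y ⧸ W) := congrArg ENat.toNat h
  refine le_antisymm hle fun x hx ↦ ?_
  have hinj := (LinearMap.injective_iff_surjective_of_finrank_eq_finrank hrank).2
    (Submodule.factor_surjective hle)
  have h0 : Submodule.factor hle (Z.mkQ x) = 0 := (Submodule.Quotient.mk_eq_zero _).2 hx
  exact (Submodule.Quotient.mk_eq_zero _).1 ((injective_iff_map_eq_zero _).1 hinj _ h0)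

lemma IsRed.codim_left_lt_top {S : Y →L[ℂ] Y} {M N : Submodule ℂ Y} (h : IsRed S M N)
    [FiniteDimensional ℂ N] : codim M < ⊤ :=
  codim_lt_top.2 (Submodule.quotientEquivOfIsCompl M N h.isCompl).symm.finiteDimensional

lemma IsRed.map_le {S : Y →L[ℂ] Y} {M N : Submodule ℂ Y} (h : IsRed S M N) :
    M.map S.toLinearMap ≤ M := by
  rintro _ ⟨x, hx, rfl⟩
  exact h.invariant_left x hx

/-- `S(M) ⊆ M` gives `codim M ≤ codim S(M)`, that is `nullity S + r ≤ r + defect S` with `r` finite.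
Equality of nullity and defect then amounts to `S(M) = M`. -/
lemma IsRed.nullity_le_defect {S : Y →L[ℂ] Y} {M N : Submodule ℂ Y} (h : IsRed S M N)
    [FiniteDimensional ℂ N] (hd : Disjoint M S.ker) : nullity S ≤ defect S := by
  obtain ⟨r, h1, h2⟩ := exists_nullity_add S M hd
  have hr : r ≠ ⊤ := fun hr ↦ by
    have := h.codim_left_lt_top
    rw [← h1, hr] at this
    simp at this
  have h3 := codim_antitone h.map_le
  rw [← h1, h2, add_comm] at h3
  exact (ENat.add_le_add_iff_left hr).1 h3

lemma IsRed.nullity_eq_defect_iff {S : Y →L[ℂ] Y} {M N : Submodule ℂ Y} (h : IsRed S M N)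
    [FiniteDimensional ℂ N] (hd : Disjoint M S.ker) :
    nullity S = defect S ↔ M.map S.toLinearMap = M := by
  obtain ⟨r, h1, h2⟩ := exists_nullity_add S M hd
  have hM := h.codim_left_lt_top
  have hr : r ≠ ⊤ := fun hr ↦ by
    rw [← h1, hr] at hM
    simp at hM
  constructor
  · intro he
    refine eq_of_codim_eq h.map_le ?_ hM
    rw [h2, ← h1, he, add_comm]
  · intro he
    rw [he, ← h1, add_comm] at h2
    exact (ENat.add_right_injective_of_ne_top hr) h2

lemma IsUpperSemiBrowder.isUpperSemiWeyl [CompleteSpace Y] {S : Y →L[ℂ] Y}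
    (h : IsUpperSemiBrowder S) : IsUpperSemiWeyl S := by
  obtain ⟨M, N, hr, hN, hd⟩ := h.1.exists_isRed h.2
  exact isUpperSemiWeyl_iff.2 ⟨h.1, hr.nullity_le_defect hd⟩

/-- Finite ascent gives `Y = M ⊕ N` with `S` injective on `M` and `N` finite-dimensional, and index
zero means `S(M) = M`. Finite descent yields this on cancelling `S ^ n` on `M`. Conversely, if `S(M)
= M`, every range contains `M`, so the ranges stabilise in the finite-dimensional `Y ⧸ M`. -/
lemma isBrowder_iff [CompleteSpace Y] {S : Y →L[ℂ] Y} :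
    IsBrowder S ↔ IsWeyl S ∧ ascent S < ⊤ := by
  rw [IsBrowder, isWeyl_iff, isFredholm_iff]
  constructor
  · rintro ⟨⟨hS, hdef⟩, ha, hde⟩
    refine ⟨⟨hS, hdef, ?_⟩, ha⟩
    obtain ⟨M, N, hr, hN, hd⟩ := hS.exists_isRed ha
    rw [hr.nullity_eq_defect_iff hd]
    refine le_antisymm hr.map_le fun m hm ↦ ?_
    obtain ⟨n, hn⟩ := descent_lt_top.1 hde
    obtain ⟨y, hy⟩ := hn m
    obtain ⟨a, ha, b, hb, rfl⟩ := hr.exists_add y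
    have hpM : ∀ k : ℕ, ∀ x ∈ M, (S ^ k) x ∈ M := by
      intro k
      induction k with
      | zero => exact fun _ hx ↦ hx
      | succ k ih => exact fun x hx ↦ by rw [pow_succ_apply']; exact hr.invariant_left _ (ih x hx)
    have hpN : ∀ k : ℕ, ∀ x ∈ N, (S ^ k) x ∈ N := by
      intro k
      induction k with
      | zero => exact fun _ hx ↦ hx
      | succ k ih => exact fun x hx ↦ by rw [pow_succ_apply']; exact hr.invariant_right _ (ih x hx)
    have h1 := (hr.eq_of_add_eq (hpM _ a ha) (hpM _ m hm) (hpN _ b hb) N.zero_mem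
      (by rw [← map_add, hy, add_zero])).1
    have hinj : ∀ k : ℕ, ∀ x ∈ M, (S ^ k) x = 0 → x = 0 := by
      intro k
      induction k with
      | zero => exact fun _ _ hx ↦ hx
      | succ k ih =>
        intro x hx hx0
        rw [pow_succ_apply'] at hx0
        exact ih x hx (Submodule.disjoint_def.1 hd _ (hpM k x hx) hx0)
    refine ⟨a, ha, ?_⟩
    rw [pow_succ_apply, ← sub_eq_zero, ← map_sub] at h1
    exact sub_eq_zero.1 (hinj n _ (sub_mem (hr.invariant_left a ha) hm) h1)
  · rintro ⟨⟨hS, hdef, he⟩, ha⟩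
    refine ⟨⟨hS, hdef⟩, ha, descent_lt_top.2 ?_⟩
    obtain ⟨M, N, hr, hN, hd⟩ := hS.exists_isRed ha
    rw [hr.nullity_eq_defect_iff hd] at he
    have hM : ∀ k : ℕ, M ≤ (S ^ k).range := by
      intro k
      induction k with
      | zero => exact fun x _ ↦ ⟨x, rfl⟩
      | succ k ih =>
        intro x hx
        rw [← he] at hx
        obtain ⟨y, hy, rfl⟩ := hx
        obtain ⟨z, rfl⟩ := ih hy
        exact ⟨z, pow_succ_apply' S k z⟩
    have := codim_lt_top.1 hr.codim_left_lt_top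
    have hanti : ∀ n m : ℕ, n ≤ m → (S ^ m).range ≤ (S ^ n).range := by
      rintro n m hnm _ ⟨x, rfl⟩
      obtain ⟨k, rfl⟩ := Nat.exists_eq_add_of_le hnm
      exact ⟨(S ^ k) x, by rw [pow_add]; rfl⟩
    obtain ⟨n, hn⟩ := IsArtinian.monotone_stabilizes
      (⟨fun n ↦ OrderDual.toDual ((S ^ n).range.map M.mkQ),
        fun n m hnm ↦ Submodule.map_mono (hanti n m hnm)⟩ : ℕ →o (Submodule ℂ (Y ⧸ M))ᵒᵈ)
    have hn : (S ^ n).range.map M.mkQ = (S ^ (n + 1)).range.map M.mkQ := hn (n + 1) (Nat.le_succ n)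
    have hn := congrArg (Submodule.comap M.mkQ) hn
    rw [Submodule.comap_map_mkQ, Submodule.comap_map_mkQ, sup_eq_right.2 (hM _),
      sup_eq_right.2 (hM _)] at hn
    refine ⟨n, fun x ↦ ?_⟩
    have hx : (S ^ n) x ∈ (S ^ n).range := ⟨x, rfl⟩
    rwa [hn] at hx

end Criteria

/-! ### Decompositions with a zeroloid summand -/

section Decomposition

variable {X : Type*} [NormedAddCommGroup X] [NormedSpace ℂ X] [CompleteSpace X]
  {S : X →L[ℂ] X} {M N : Submodule ℂ X}

lemma IsRed.bijective_restrict_sub_smul (h : IsRed S M N) {w : ℂ}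
    (hw : w ∉ spectrum ℂ (S.restrict h.invariant_right)) :
    Function.Bijective ((S - w • (1 : X →L[ℂ] X)).restrict (h.sub_smul w).invariant_right) := by
  have := h.isClosed_right.completeSpace_coe
  exact notMem_spectrum_iff.1 hw

omit [CompleteSpace X] in
lemma isRed_top_bot (S : X →L[ℂ] X) : IsRed S ⊤ ⊥ where
  isClosed_left := isClosed_univ
  isClosed_right := isClosed_singleton
  invariant_left _ _ := trivial
  invariant_right x hx := by
    rw [Submodule.mem_bot] at hx ⊢
    rw [hx, map_zero]
  isCompl := isCompl_top_bot

omit [CompleteSpace X] in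
lemma bijective_restrict_bot (S : X →L[ℂ] X) :
    Function.Bijective (S.restrict (isRed_top_bot S).invariant_right) :=
  ⟨Function.injective_of_subsingleton _, Function.surjective_to_subsingleton _⟩

/-- The definition allows different pairs for Fredholmness and for the index. The index pair alone
suffices, since index zero makes its left part Fredholm. -/
lemma isGzWeyl_iff : IsGzWeyl S ↔ ∃ (M N : Submodule ℂ X) (h : IsRed S M N),
    IsWeyl (S.restrict h.invariant_left) ∧ IsZeroloid (S.restrict h.invariant_right) := by
  constructor
  · rintro ⟨-, M, N, h, hsf, hz, hi⟩
    refine ⟨M, N, h, ⟨?_, hi⟩, hz⟩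
    have := h.isClosed_left.completeSpace_coe
    obtain ⟨h1, h2⟩ := ind_eq_zero_iff.1 hi
    refine isFredholm_iff.2 ⟨⟨?_, h2⟩, h1 ▸ h2⟩
    exact hsf.elim (fun h ↦ h.1) (fun h ↦ h.1)
  · rintro ⟨M, N, h, hW, hz⟩
    have := h.isClosed_left.completeSpace_coe
    exact ⟨⟨M, N, h, hW.1, hz⟩, M, N, h, Or.inl (isFredholm_iff.1 hW.1).1, hz, hW.2⟩

omit [CompleteSpace X] in
lemma isUpperSemiGzWeyl_iff : IsUpperSemiGzWeyl S ↔ ∃ (M N : Submodule ℂ X) (h : IsRed S M N),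
    IsUpperSemiWeyl (S.restrict h.invariant_left) ∧
      IsZeroloid (S.restrict h.invariant_right) := by
  constructor
  · rintro ⟨-, k, ⟨M, N, h, hsf, hz, rfl⟩, hi⟩
    refine ⟨M, N, h, ⟨?_, hi⟩, hz⟩
    rcases hsf with h1 | h1
    · exact h1
    -- For a lower semi-Fredholm left part, nonpositive index bounds the nullity by the finite
    -- defect.
    · exact ⟨h1.1, (ind_nonpos_iff.1 hi).trans_lt h1.2⟩
  · rintro ⟨M, N, h, hW, hz⟩
    exact ⟨⟨M, N, h, hW.1, hz⟩, _, ⟨M, N, h, Or.inl hW.1, hz, rfl⟩, hW.2⟩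

/-- A finite ascent of the left part improves it to a bounded below operator. -/
lemma IsRed.exists_isBoundedBelow (h : IsRed S M N)
    (hM : IsUpperSemiFredholm (S.restrict h.invariant_left))
    (ha : ascent (S.restrict h.invariant_left) < ⊤)
    (hz : IsZeroloid (S.restrict h.invariant_right)) :
    ∃ (M' N' : Submodule ℂ X) (h' : IsGzKD S M' N'),
      IsBoundedBelow (S.restrict h'.invariant_left) ∧
      (nullity (S.restrict h.invariant_left) = defect (S.restrict h.invariant_left) →
        Function.Surjective (S.restrict h'.invariant_left)) := by
  have := h.isClosed_left.completeSpace_coe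
  obtain ⟨M₁, M₂, hr, hfin, hd⟩ := hM.exists_isRed ha
  have hred := h.trans hr
  have hbb : IsBoundedBelow (S.restrict hred.invariant_left) := by
    rw [isBoundedBelow_iff]
    constructor
    · have hc : IsClosed (((M₁.map (S.restrict h.invariant_left).toLinearMap).map M.subtype :
          Submodule ℂ X) : Set X) := by
        rw [Submodule.map_coe]
        exact h.isClosed_left.isClosedEmbedding_subtypeVal.isClosedMap _
          (hM.isClosed_map hr.isClosed_left)
      have he : ((S.restrict hred.invariant_left).range : Set (M₁.map M.subtype)) =
          (Subtype.val : (M₁.map M.subtype) → X) ⁻¹'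
            ((M₁.map (S.restrict h.invariant_left).toLinearMap).map M.subtype : Submodule ℂ X) := by
        ext x
        constructor
        · rintro ⟨⟨_, y, hy, rfl⟩, rfl⟩
          exact ⟨_, ⟨y, hy, rfl⟩, rfl⟩
        · rintro ⟨_, ⟨y, hy, rfl⟩, hx⟩
          exact ⟨⟨_, y, hy, rfl⟩, Subtype.ext hx⟩
      rw [he]
      exact hc.preimage continuous_subtype_val
    · refine (injective_iff_map_eq_zero _).2 ?_
      rintro ⟨_, y, hy, rfl⟩ h0
      have h0 : S y = 0 := congrArg (fun z : M₁.map M.subtype ↦ (z : X)) h0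
      have hy0 : y = 0 := Submodule.disjoint_def.1 hd y hy (Subtype.ext h0)
      exact Subtype.ext (by simp [hy0])
  refine ⟨_, _, ⟨hred, hbb.isSemiRegular, ?_⟩, hbb, fun he ↦ ?_⟩
  · refine IsZeroloid.sup (Submodule.closed_of_finiteDimensional _) h.isClosed_right
      hred.isClosed_right ?_ ?_ h.invariant_right _ (isZeroloid_of_finiteDimensional _) hz
    · exact h.isCompl.disjoint.mono_left (Submodule.map_subtype_le _ _)
    · rintro _ ⟨x, hx, rfl⟩
      exact ⟨_, hr.invariant_right x hx, rfl⟩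
  · rw [hr.nullity_eq_defect_iff hd] at he
    rintro ⟨_, x, hx, rfl⟩
    rw [← he] at hx
    obtain ⟨y, hy, rfl⟩ := hx
    exact ⟨⟨_, y, hy, rfl⟩, rfl⟩

/-- If the bounded below left part were not onto, its translates by small `w` would have defect at
least `1`, while those of the surjective left part have defect `0`. For `w` outside the spectra of
both zeroloid parts, each of these is the defect of `S - w`, a contradiction. -/
lemma IsGzInvertible.exists_bijective (h : IsGzInvertible S) :
    ∃ (M N : Submodule ℂ X) (h : IsRed S M N),
      Function.Bijective (S.restrict h.invariant_left) ∧
      IsZeroloid (S.restrict h.invariant_right) := by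
  obtain ⟨⟨M, N, h, hb⟩, M', N', h', hs⟩ := h
  refine ⟨M, N, h.toIsRed, ⟨(isBoundedBelow_iff.1 hb).2, ?_⟩, h.zeroloid_right⟩
  have := h.isClosed_left.completeSpace_coe
  have := h'.isClosed_left.completeSpace_coe
  rw [← defect_eq_zero]
  by_contra hne
  have hle : ((1 : ℕ) : ℕ∞) ≤ codim (S.restrict h.invariant_left).range := by
    rw [Nat.cast_one, Order.one_le_iff_ne_zero]
    exact hne
  obtain ⟨hcl, hi⟩ := isBoundedBelow_iff.1 hb
  obtain ⟨ε₁, hε₁, H₁⟩ := exists_perturbation_le_codim hi hcl hle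
  obtain ⟨ε₂, hε₂, H₂⟩ := exists_perturbation_surjective hs
  have hz : derivedSet (spectrum ℂ (S.restrict h.invariant_right) ∪
      spectrum ℂ (S.restrict h'.invariant_right)) ⊆ {0} := by
    rw [derivedSet_union]
    exact Set.union_subset h.zeroloid_right h'.zeroloid_right
  obtain ⟨w, hw, hmem⟩ := exists_small_notMem_of_derivedSet_subset hz (lt_min hε₁ hε₂)
  rw [lt_min_iff] at hw
  rw [Set.mem_union, not_or] at hmem
  have h1 := H₁ _ ((norm_sub_smul_one_sub_le _ w).trans_lt hw.1)
  have h2 := defect_eq_zero.2 (H₂ _ ((norm_sub_smul_one_sub_le _ w).trans_lt hw.2))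
  have h3 := (h.toIsRed.sub_smul w).defect_eq (h.toIsRed.bijective_restrict_sub_smul hmem.1).2
  have h4 := (h'.toIsRed.sub_smul w).defect_eq (h'.toIsRed.bijective_restrict_sub_smul hmem.2).2
  have h5 : defect (S.restrict h.invariant_left - w • 1) = 0 := h3.symm.trans (h4.trans h2)
  rw [← defect_eq_codim, h5] at h1
  simp at h1

/-- Near `0`, outside the spectrum of the zeroloid part, `S - w` behaves like its left part. -/
lemma IsRed.exists_small (h : IsRed S M N) (hz : IsZeroloid (S.restrict h.invariant_right))
    {ε : ℝ} (hε : 0 < ε) : ∃ w : ℂ, ‖w‖ < ε ∧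
      nullity (S - w • (1 : X →L[ℂ] X)) = nullity (S.restrict h.invariant_left - w • 1) ∧
      defect (S - w • (1 : X →L[ℂ] X)) = defect (S.restrict h.invariant_left - w • 1) ∧
      (IsUpperSemiFredholm (S - w • (1 : X →L[ℂ] X)) ↔
        IsUpperSemiFredholm (S.restrict h.invariant_left - w • 1)) ∧
      (ascent (S - w • (1 : X →L[ℂ] X)) < ⊤ →
        ascent (S.restrict h.invariant_left - w • 1) < ⊤) := by
  obtain ⟨w, hw, hmem⟩ := exists_small_notMem_of_derivedSet_subset hz hε
  have hb := h.bijective_restrict_sub_smul hmem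
  exact ⟨w, hw, (h.sub_smul w).nullity_eq hb.1, (h.sub_smul w).defect_eq hb.2,
    (h.sub_smul w).isUpperSemiFredholm_iff hb, ascent_restrict_lt_top (h.sub_smul w).invariant_left⟩

/-- An upper semi-Fredholm operator that splits as bounded below plus zeroloid has finite ascent. -/
lemma IsUpperSemiFredholm.ascent_lt_top_of_isRed (hS : IsUpperSemiFredholm S) (h : IsRed S M N)
    (hb : IsBoundedBelow (S.restrict h.invariant_left))
    (hz : IsZeroloid (S.restrict h.invariant_right)) : ascent S < ⊤ := by
  have := h.isClosed_left.completeSpace_coe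
  obtain ⟨hcl, hi⟩ := isBoundedBelow_iff.1 hb
  obtain ⟨ε₀, hε₀, H⟩ := exists_perturbation_injective hi hcl
  refine hS.ascent_lt_top fun ε hε ↦ ?_
  obtain ⟨w, hw, hn, -⟩ := h.exists_small hz (lt_min hε hε₀)
  rw [lt_min_iff] at hw
  refine ⟨w, hw.1, ascent_lt_top_of_injective ?_⟩
  rw [← nullity_eq_zero, hn, nullity_eq_zero]
  exact (H _ ((norm_sub_smul_one_sub_le _ w).trans_lt hw.2)).1

/-- The left part of `S` has finite ascent if `S - w` has finite ascent for all small `w` at which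
`S - w` has the nullity and defect of its left part. -/
lemma IsRed.ascent_left_lt_top (h : IsRed S M N)
    (hM : IsUpperSemiFredholm (S.restrict h.invariant_left))
    (hz : IsZeroloid (S.restrict h.invariant_right)) {ε₀ : ℝ} (hε₀ : 0 < ε₀)
    (H : ∀ w : ℂ, ‖w‖ < ε₀ →
      nullity (S - w • (1 : X →L[ℂ] X)) = nullity (S.restrict h.invariant_left - w • 1) →
      defect (S - w • (1 : X →L[ℂ] X)) = defect (S.restrict h.invariant_left - w • 1) →
      IsUpperSemiFredholm (S - w • (1 : X →L[ℂ] X)) → ascent (S - w • (1 : X →L[ℂ] X)) < ⊤) :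
    ascent (S.restrict h.invariant_left) < ⊤ := by
  have := h.isClosed_left.completeSpace_coe
  obtain ⟨ε₁, hε₁, H₁⟩ := hM.exists_perturbation
  refine hM.ascent_lt_top fun ε hε ↦ ?_
  obtain ⟨w, hw, hn, hd, hf, ha⟩ := h.exists_small hz (lt_min hε (lt_min hε₀ hε₁))
  rw [lt_min_iff, lt_min_iff] at hw
  refine ⟨w, hw.1, ha (H w hw.2.1 hn hd (hf.2 ?_))⟩
  exact (H₁ _ ((norm_sub_smul_one_sub_le _ w).trans_lt hw.2.2)).1

end Decomposition

/-! ### Passage between the classical and the `g_z`-classes -/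

section Theorem

variable {X : Type*} [NormedAddCommGroup X] [NormedSpace ℂ X]

lemma spectrumOf_eq_iff {P Q : (X →L[ℂ] X) → Prop} {T : X →L[ℂ] X} :
    spectrumOf P T = spectrumOf Q T ↔
      ∀ z : ℂ, P (T - z • (1 : X →L[ℂ] X)) ↔ Q (T - z • (1 : X →L[ℂ] X)) := by
  rw [Set.ext_iff]
  exact forall_congr' fun z ↦ not_iff_not

lemma sub_smul_sub_smul (T : X →L[ℂ] X) (z w : ℂ) :
    T - z • (1 : X →L[ℂ] X) - w • (1 : X →L[ℂ] X) = T - (z + w) • (1 : X →L[ℂ] X) := by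
  rw [add_smul, sub_sub]

variable [CompleteSpace X] {S : X →L[ℂ] X}

omit [CompleteSpace X] in
lemma isZeroloid_restrict_bot (S : X →L[ℂ] X) :
    IsZeroloid (S.restrict (isRed_top_bot S).invariant_right) :=
  isZeroloid_of_finiteDimensional _

lemma isUpperSemiFredholm_restrict_top :
    IsUpperSemiFredholm (S.restrict (isRed_top_bot S).invariant_left) ↔ IsUpperSemiFredholm S :=
  ((isRed_top_bot S).isUpperSemiFredholm_iff (bijective_restrict_bot S)).symm

omit [CompleteSpace X] in
lemma nullity_restrict_top : nullity (S.restrict (isRed_top_bot S).invariant_left) = nullity S :=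
  ((isRed_top_bot S).nullity_eq (bijective_restrict_bot S).1).symm

omit [CompleteSpace X] in
lemma defect_restrict_top : defect (S.restrict (isRed_top_bot S).invariant_left) = defect S :=
  ((isRed_top_bot S).defect_eq (bijective_restrict_bot S).2).symm

lemma completeSpace_top : CompleteSpace (⊤ : Submodule ℂ X) :=
  (isClosed_univ (X := X)).completeSpace_coe

lemma _root_.ContinuousLinearMap.IsFredholm.isGzFredholm (h : S.IsFredholm) : IsGzFredholm S := by
  have := completeSpace_top (X := X)
  refine ⟨⊤, ⊥, isRed_top_bot S, ?_, isZeroloid_restrict_bot S⟩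
  rwa [isFredholm_iff, isUpperSemiFredholm_restrict_top, defect_restrict_top, ← isFredholm_iff]

lemma IsWeyl.isGzWeyl (h : IsWeyl S) : IsGzWeyl S := by
  have := completeSpace_top (X := X)
  refine isGzWeyl_iff.2 ⟨⊤, ⊥, isRed_top_bot S, ?_, isZeroloid_restrict_bot S⟩
  rwa [isWeyl_iff, isUpperSemiFredholm_restrict_top, defect_restrict_top, nullity_restrict_top,
    ← isWeyl_iff]

lemma IsUpperSemiWeyl.isUpperSemiGzWeyl (h : IsUpperSemiWeyl S) : IsUpperSemiGzWeyl S := by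
  refine isUpperSemiGzWeyl_iff.2 ⟨⊤, ⊥, isRed_top_bot S, ?_, isZeroloid_restrict_bot S⟩
  rwa [isUpperSemiWeyl_iff, isUpperSemiFredholm_restrict_top, defect_restrict_top,
    nullity_restrict_top, ← isUpperSemiWeyl_iff]

lemma isWeyl_of_bijective (h : Function.Bijective S) : IsWeyl S := by
  have h1 := nullity_eq_zero.2 h.1
  have h2 := defect_eq_zero.2 h.2
  refine isWeyl_iff.2 ⟨⟨?_, ?_⟩, ?_, ?_⟩
  · rw [LinearMap.range_eq_top.2 h.2]
    exact isClosed_univ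
  · simp [h1]
  · simp [h2]
  · rw [h1, h2]

lemma IsGzInvertible.isGzWeyl (h : IsGzInvertible S) : IsGzWeyl S := by
  obtain ⟨M, N, h, hb, hz⟩ := h.exists_bijective
  have := h.isClosed_left.completeSpace_coe
  exact isGzWeyl_iff.2 ⟨M, N, h, isWeyl_of_bijective hb, hz⟩

omit [CompleteSpace X] in
lemma IsLeftGzInvertible.isUpperSemiGzWeyl (h : IsLeftGzInvertible S) : IsUpperSemiGzWeyl S := by
  obtain ⟨M, N, h, hb⟩ := h
  refine isUpperSemiGzWeyl_iff.2 ⟨M, N, h.toIsRed, isUpperSemiWeyl_iff.2 ⟨hb.1, ?_⟩,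
    h.zeroloid_right⟩
  rw [hb.2]
  exact zero_le

lemma IsRed.isGzInvertible {M N : Submodule ℂ X} (h : IsRed S M N)
    (hM : IsUpperSemiFredholm (S.restrict h.invariant_left))
    (ha : ascent (S.restrict h.invariant_left) < ⊤)
    (he : nullity (S.restrict h.invariant_left) = defect (S.restrict h.invariant_left))
    (hz : IsZeroloid (S.restrict h.invariant_right)) : IsGzInvertible S := by
  obtain ⟨M', N', h', hb, hs⟩ := h.exists_isBoundedBelow hM ha hz
  exact ⟨⟨M', N', h', hb⟩, M', N', h', hs he⟩

lemma IsGzWeyl.isGzInvertible (h : IsGzWeyl S)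
    (hB : ∀ w : ℂ, IsWeyl (S - w • (1 : X →L[ℂ] X)) → IsBrowder (S - w • (1 : X →L[ℂ] X))) :
    IsGzInvertible S := by
  obtain ⟨M, N, h, hW, hz⟩ := isGzWeyl_iff.1 h
  have := h.isClosed_left.completeSpace_coe
  obtain ⟨hM, hd, he⟩ := isWeyl_iff.1 hW
  obtain ⟨ε, hε, H⟩ := hM.exists_perturbation
  refine h.isGzInvertible hM (h.ascent_left_lt_top hM hz hε fun w hw hn' hd' hf' ↦ ?_) he hz
  obtain ⟨-, -, h3⟩ := H _ ((norm_sub_smul_one_sub_le _ w).trans_lt hw)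
  obtain ⟨h3, h4⟩ := h3 hd
  exact (hB w (isWeyl_iff.2 ⟨hf', hd' ▸ h3, hn'.trans ((h4.1 he).trans hd'.symm)⟩)).2.1

lemma IsGzFredholm.isGzInvertible (h : IsGzFredholm S)
    (hB : ∀ w : ℂ, (S - w • (1 : X →L[ℂ] X)).IsFredholm → IsBrowder (S - w • (1 : X →L[ℂ] X))) :
    IsGzInvertible S := by
  obtain ⟨M, N, h, hF, hz⟩ := h
  have := h.isClosed_left.completeSpace_coe
  obtain ⟨hM, hd⟩ := isFredholm_iff.1 hF
  obtain ⟨ε, hε, H⟩ := hM.exists_perturbation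
  have key : ∀ w : ℂ, ‖w‖ < ε →
      defect (S - w • (1 : X →L[ℂ] X)) = defect (S.restrict h.invariant_left - w • 1) →
      IsUpperSemiFredholm (S - w • (1 : X →L[ℂ] X)) → IsBrowder (S - w • (1 : X →L[ℂ] X)) := by
    intro w hw hd' hf'
    obtain ⟨-, -, h3⟩ := H _ ((norm_sub_smul_one_sub_le _ w).trans_lt hw)
    exact hB w (isFredholm_iff.2 ⟨hf', hd' ▸ (h3 hd).1⟩)
  refine h.isGzInvertible hM (h.ascent_left_lt_top hM hz hε fun w hw hn' hd' hf' ↦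
    (key w hw hd' hf').2.1) ?_ hz
  -- Index zero of the left part is not given: it is read off from a nearby `S - w`, which is
  -- Browder and hence Weyl.
  obtain ⟨w, hw, hn', hd', hf', -⟩ := h.exists_small hz hε
  obtain ⟨h1, -, h3⟩ := H _ ((norm_sub_smul_one_sub_le _ w).trans_lt hw)
  have hBr := key w hw hd' (hf'.2 h1)
  rw [(h3 hd).2, ← hn', ← hd']
  exact (isWeyl_iff.1 (isBrowder_iff.1 hBr).1).2.2

lemma IsUpperSemiGzWeyl.isLeftGzInvertible (h : IsUpperSemiGzWeyl S)
    (hB : ∀ w : ℂ, IsUpperSemiWeyl (S - w • (1 : X →L[ℂ] X)) →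
      IsUpperSemiBrowder (S - w • (1 : X →L[ℂ] X))) :
    IsLeftGzInvertible S := by
  obtain ⟨M, N, h, hW, hz⟩ := isUpperSemiGzWeyl_iff.1 h
  have := h.isClosed_left.completeSpace_coe
  obtain ⟨hM, hle⟩ := isUpperSemiWeyl_iff.1 hW
  obtain ⟨ε, hε, H⟩ := hM.exists_perturbation
  have ha := h.ascent_left_lt_top hM hz hε fun w hw hn' hd' hf' ↦ by
    obtain ⟨-, h2, -⟩ := H _ ((norm_sub_smul_one_sub_le _ w).trans_lt hw)
    refine (hB w (isUpperSemiWeyl_iff.2 ⟨hf', ?_⟩)).2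
    rw [hn', hd']
    exact h2 hle
  obtain ⟨M', N', h', hb, -⟩ := h.exists_isBoundedBelow hM ha hz
  exact ⟨M', N', h', hb⟩

lemma IsUpperSemiFredholm.isUpperSemiBrowder (hS : IsUpperSemiFredholm S)
    (h : IsLeftGzInvertible S) : IsUpperSemiBrowder S := by
  obtain ⟨M, N, h, hb⟩ := h
  exact ⟨hS, hS.ascent_lt_top_of_isRed h.toIsRed hb h.zeroloid_right⟩

lemma _root_.ContinuousLinearMap.IsFredholm.isBrowder (hS : S.IsFredholm) (h : IsGzInvertible S) :
    IsBrowder S := by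
  obtain ⟨hS, hd⟩ := isFredholm_iff.1 hS
  refine isBrowder_iff.2 ⟨isWeyl_iff.2 ⟨hS, hd, ?_⟩, (hS.isUpperSemiBrowder h.1).2⟩
  obtain ⟨M, N, h, hb, hz⟩ := h.exists_bijective
  have := h.isClosed_left.completeSpace_coe
  obtain ⟨ε₁, hε₁, H₁⟩ := hS.exists_perturbation
  obtain ⟨ε₂, hε₂, H₂⟩ := exists_perturbation_bijective hb
  -- For this `w` the left part of `S - w` is bijective, so `S - w` has nullity and defect zero;
  -- stability carries the equality back to `S`.
  obtain ⟨w, hw, hn', hd', -⟩ := h.exists_small hz (lt_min hε₁ hε₂)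
  rw [lt_min_iff] at hw
  obtain ⟨-, -, h3⟩ := H₁ _ ((norm_sub_smul_one_sub_le _ w).trans_lt hw.1)
  have h4 := H₂ _ ((norm_sub_smul_one_sub_le _ w).trans_lt hw.2)
  rw [(h3 hd).2, hn', hd', nullity_eq_zero.2 h4.1, defect_eq_zero.2 h4.2]

end Theorem

end GzSpectral

theorem theorem4p1 {X : Type*} [NormedAddCommGroup X] [NormedSpace ℂ X] [CompleteSpace X]
    (T : X →L[ℂ] X) :
    (SatisfiesBrowder T ↔ spectrumOf IsGzWeyl T = spectrumOf IsGzInvertible T) ∧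
    (SatisfiesEssentialBrowder T ↔ spectrumOf IsGzFredholm T = spectrumOf IsGzInvertible T) ∧
    (SatisfiesABrowder T ↔ spectrumOf IsUpperSemiGzWeyl T = spectrumOf IsLeftGzInvertible T) := by
  simp only [SatisfiesBrowder, SatisfiesEssentialBrowder, SatisfiesABrowder, spectrumOf_eq_iff]
  refine ⟨⟨fun H z ↦ ⟨fun h ↦ h.isGzInvertible fun w hw ↦ ?_, fun h ↦ h.isGzWeyl⟩,
      fun H z ↦ ⟨fun h ↦ h.1.isBrowder ((H z).1 h.isGzWeyl), fun h ↦ (isBrowder_iff.1 h).1⟩⟩,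
    ⟨fun H z ↦ ⟨fun h ↦ h.isGzInvertible fun w hw ↦ ?_, fun h ↦ h.isGzWeyl.1⟩,
      fun H z ↦ ⟨fun h ↦ h.isBrowder ((H z).1 h.isGzFredholm), fun h ↦ h.1⟩⟩,
    ⟨fun H z ↦ ⟨fun h ↦ h.isLeftGzInvertible fun w hw ↦ ?_, fun h ↦ h.isUpperSemiGzWeyl⟩,
      fun H z ↦ ⟨fun h ↦ h.1.isUpperSemiBrowder ((H z).1 h.isUpperSemiGzWeyl),
        fun h ↦ h.isUpperSemiWeyl⟩⟩⟩
  -- What remains is the classical hypothesis at the shifted point `z + w`.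
  all_goals
    rw [sub_smul_sub_smul] at hw ⊢
    exact (H _).1 hw
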